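/- For $\nu\in\mathbb R$ and $r>0$ let $$K_\nu(r)=\frac{\Gamma(1/2)\,r^{|\nu|}}{2^{|\nu|}\,\Gamma(|\nu|+\frac12)}\int_1^\infty e^{-rt}(t^2-1)^{|\nu|-\frac12}\,dt$$ be the modified Bessel function of the second kind. For $\alpha\in\mathbb R\setminus\mathbb N_0$ and $c>0$ let $$\widehat{\phi_{\alpha,c}}(\xi)=\frac{2^{1+\alpha}}{\Gamma(-\alpha)}\left(\frac{c}{|\xi|}\right)^{\alpha+\frac12}K_{\alpha+\frac12}(c|\xi|),\qquad \xi\in\mathbb R\setminus\{0\},$$ which, up to a normalization constant, is the generalized Fourier transform of the general multiquadric $\phi_{\alpha,c}(x)=(x^2+c^2)^\alpha$ on $\mathbb R$. For almost every $\xi\in\mathbb R$ and for all $x\in\mathbb R$ put $$\widehat{L_{\alpha,c}}(\xi)=\frac{\widehat{\phi_{\alpha,c}}(\xi)}{\sum_{j\in\mathbb Z}\widehat{\phi_{\alpha,c}}(\xi+2\pi j)},\qquad L_{\alpha,c}(x)=\frac1{2\pi}\int_{\mathbb R}\widehat{L_{\alpha,c}}(\xi)e^{ix\xi}\,d\xi,$$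 $$\Lambda_{\alpha,c}(x)=\sum_{j\in\mathbb Z}|L_{\alpha,c}(x+j)|,\qquad \mathcal I_{\alpha,c}\mathbf y(x)=\sum_{j\in\mathbb Z}y_jL_{\alpha,c}(x-j)$$ for complex sequences $\mathbf y=(y_j)_{j\in\mathbb Z}$. **Proposition.** Let $\alpha\in(-\infty,-3/2)\cup\big([1/2,\infty)\setminus\mathbb N\big)$. There is a constant $A_\alpha>0$, depending only on $\alpha$, such that for every $c\ge 1$ the function $\widehat{L_{\alpha,c}}$ is integrable and the following hold. (i) For every $x\in\mathbb R$ the series $\Lambda_{\alpha,c}(x)$ converges and $\Lambda_{\alpha,c}(x)\le A_\alpha(1+\ln c)$. (ii) For every $\mathbf y\in\ell_\infty(\mathbb Z)$ the series $\mathcal I_{\alpha,c}\mathbf y(x)$ converges absolutely for every $x\in\mathbb R$; $\mathcal I_{\alpha,c}$ is a bounded linear operator from $\ell_\infty(\mathbb Z)$ to $L_\infty(\mathbb R)$, and $\|\mathcal I_{\alpha,c}\|_{\ell_\infty\to L_\infty}\le A_\alpha(1+\ln c)$. (iii) $\mathcal I_{\alpha,c}$ is likewise a bounded linear operator from $\ell_1(\mathbb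 Z)$ to $L_1(\mathbb R)$, and $\|\mathcal I_{\alpha,c}\|_{\ell_1\to L_1}\le A_\alpha(1+\ln c)$. -/

import Mathlib

open MeasureTheory

noncomputable section

namespace Multiquadric

/-- The modified Bessel function of the second kind of real order `ν`, for `r > 0`: the classical
integral for nonnegative order, extended by `K_{-ν} = K_ν`. -/
def besselK (ν r : ℝ) : ℝ :=
  Real.Gamma (1 / 2) * r ^ |ν| / (2 ^ |ν| * Real.Gamma (|ν| + 1 / 2)) *
    ∫ x in Set.Ioi (1 : ℝ), Real.exp (-r * x) * (x ^ 2 - 1) ^ (|ν| - 1 / 2)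

/-- The generalized Fourier transform, away from the origin, of the univariate general multiquadric
`x ↦ (x ^ 2 + c ^ 2) ^ α` with `α` not a nonnegative integer. (The value at `ξ = 0` is irrelevant
below, and so is the factor `√(2π)` by which the transform with kernel `exp (-i x ξ)` differs from
the one with kernel `exp (-i x ξ) / √(2π)`: it cancels in `fundamentalHat`.) -/
def phiHat (α c ξ : ℝ) : ℝ :=
  2 ^ (1 + α) / Real.Gamma (-α) * (c / |ξ|) ^ (α + 1 / 2) * besselK (α + 1 / 2) (c * |ξ|)

/-- The Fourier transform of the fundamental function. It is meaningful for `ξ ∉ 2πℤ`, hence almost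
everywhere. -/
def fundamentalHat (α c ξ : ℝ) : ℝ :=
  phiHat α c ξ / ∑' j : ℤ, phiHat α c (ξ + 2 * Real.pi * j)

/-- The fundamental function `L_{α,c}`, the inverse Fourier transform of `fundamentalHat α c`. -/
def fundamentalFn (α c x : ℝ) : ℂ :=
  1 / (2 * Real.pi) * ∫ ξ : ℝ, (fundamentalHat α c ξ : ℂ) * Complex.exp (Complex.I * x * ξ)

/-- The Lebesgue-type function `Λ_{α,c}(x) = ∑_{j ∈ ℤ} |L_{α,c}(x + j)|`. -/
def lebesgueFn (α c x : ℝ) : ℝ := ∑' j : ℤ, ‖fundamentalFn α c (x + j)‖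

/-- The cardinal interpolant `𝓘_{α,c} y (x) = ∑_{j ∈ ℤ} y_j L_{α,c}(x - j)`. -/
def cardinalInterp (α c : ℝ) (y : ℤ → ℂ) (x : ℝ) : ℂ := ∑' j : ℤ, y j * fundamentalFn α c (x - j)

/-- `T` is the cardinal interpolation operator `𝓘_{α,c}` as a bounded operator from `ℓ_p(ℤ)` to
`L_p(ℝ)`: for every `y ∈ ℓ_p` the defining series converges absolutely at every point, and `T y` is
the class of its sum. -/
def IsInterpOperator (α c : ℝ) (p : ENNReal) [Fact (1 ≤ p)]
    (T : lp (fun _ : ℤ => ℂ) p →L[ℂ] Lp ℂ p (volume : Measure ℝ)) : Prop :=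
  ∀ y : lp (fun _ : ℤ => ℂ) p,
    (∀ x : ℝ, Summable fun j : ℤ => y j * fundamentalFn α c (x - j)) ∧
      T y =ᵐ[volume] cardinalInterp α c y

end Multiquadric

end

namespace Multiquadric

open Set Filter Topology

/-! ### The radial profile -/

/-! Put `ξ = 2πs`, `κ = 2πc`, `a = α + 1/2`. Up to a constant that cancels in the quotient, `phiHat`
is `g(s) = |s|^{-σ} F(κ|s|)` with `σ = a + |a|` and `F = profile p`, `p = |a| - 1/2`. The transform
of the fundamental function is thus `g(s) / ∑ g(s + m)`, a continuous function (`cardinalHat`) once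
the singularity at the integers is removed.

`F` decays exponentially and `|F'| ≤ F`. For `|s| ≤ 1/2` the term `g(s)` therefore dominates its
translates: `g(s + k)`, `k ≠ 0`, is smaller by `e^{-|k|}` and by `layer κ s`, which is of order 1
only within about `1/κ` of `s = ±1/2` (`exists_radial_ratio_le`). By the quotient rule, the
derivative at `s + k` is a sum over `m` of Wronskians `g'(s+k) g(s+m) - g(s+k) g'(s+m)`, divided by
the square of the denominator. The term `k = m = 0` vanishes, so each remaining one carries the
layer factor, and the derivative is `O(κ e^{-|k|} layer κ s)`.

The layer has integral `O(1/κ)`, so the derivative is `O(1)` in `L_1`, and its periodization against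
any character has squared `L_2` norm `O(κ)` over a period. For the kernel `L` this gives `|L(y)| ≤
B`, `|y L(y)| ≤ B` and, by Parseval, `∑_j |(x+j) L(x+j)|² ≤ B κ`. The second bound, summed over `|y|
≤ κ`, costs `log κ`; the third makes the tail `|y| > κ` cost `O(1)` (`summable_and_tsum_le`). This
bounds the Lebesgue function. Its supremum controls the operator on `ℓ_∞`, and its integral over a
period, which is `‖L‖_1`, the operator on `ℓ_1`. -/

/-- `∫_0^∞ e^{-u} (u (u + 2 r))^p du`, which equals `e^r r^{2 p + 1} ∫_1^∞ e^{-r t} (t² - 1)^p dt`. -/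
noncomputable def polyPart (p r : ℝ) : ℝ :=
  ∫ u in Ioi (0 : ℝ), Real.exp (-u) * (u * (u + 2 * r)) ^ p

/-- `e^{-r} polyPart p r`, a constant multiple of `r^ν K_ν(r)` with `ν = p + 1/2`. -/
noncomputable def profile (p r : ℝ) : ℝ := Real.exp (-r) * polyPart p r

lemma exists_rpow_le_exp {p ε : ℝ} (hp : 0 < p) (hε : 0 < ε) :
    ∃ K : ℝ, 0 < K ∧ ∀ x : ℝ, 0 ≤ x → x ^ p ≤ K * Real.exp (ε * x) := by
  refine ⟨(p / ε) ^ p, by positivity, fun x hx => ?_⟩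
  have h1 : ε * x / p ≤ Real.exp (ε * x / p) := by linarith [Real.add_one_le_exp (ε * x / p)]
  have h2 : x = (p / ε) * (ε * x / p) := by field_simp
  calc x ^ p = ((p / ε) * (ε * x / p)) ^ p := by rw [← h2]
    _ = (p / ε) ^ p * (ε * x / p) ^ p := by rw [Real.mul_rpow (by positivity) (by positivity)]
    _ ≤ (p / ε) ^ p * (Real.exp (ε * x / p)) ^ p := by gcongr
    _ = (p / ε) ^ p * Real.exp (ε * x) := by
      rw [← Real.exp_mul]; congr 2; field_simp

lemma integrableOn_exp_neg_mul {b : ℝ} (hb : 0 < b) (K : ℝ) :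
    IntegrableOn (fun u => K * Real.exp (-b * u)) (Ioi (0 : ℝ)) :=
  (exp_neg_integrableOn_Ioi 0 hb).const_mul K

/-- Exponential growth of rate 1/4 in `u + 2r` beats the power, at the price of `e^{r/2}`. This
single majorant serves integrability, continuity and differentiation in `r`, and the decay of
`profile`. -/
lemma polyPart_integrand_le {p : ℝ} (hp : 0 < p) : ∃ K : ℝ, 0 < K ∧ ∀ r u : ℝ, 0 ≤ r → 0 < u →
    Real.exp (-u) * (u * (u + 2 * r)) ^ p ≤ K * Real.exp (r / 2) * Real.exp (-(3 / 4) * u) := by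
  obtain ⟨K, hK, h⟩ := exists_rpow_le_exp (p := 2 * p) (ε := 1 / 4) (by linarith) (by norm_num)
  refine ⟨K, hK, fun r u hr hu => ?_⟩
  have h1 : (u * (u + 2 * r)) ^ p ≤ (u + 2 * r) ^ (2 * p) := by
    rw [Real.rpow_mul (by positivity), Real.rpow_two]
    gcongr
    nlinarith
  calc Real.exp (-u) * (u * (u + 2 * r)) ^ p
      ≤ Real.exp (-u) * (K * Real.exp (1 / 4 * (u + 2 * r))) := by
        gcongr; exact h1.trans (h _ (by positivity))
    _ = K * Real.exp (r / 2) * Real.exp (-(3 / 4) * u) := by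
      have : Real.exp (-u) * Real.exp (1 / 4 * (u + 2 * r))
          = Real.exp (r / 2) * Real.exp (-(3 / 4) * u) := by
        rw [← Real.exp_add, ← Real.exp_add]; congr 1; ring
      linear_combination K * this

lemma measurable_polyPart_integrand (p r : ℝ) :
    Measurable fun u : ℝ => Real.exp (-u) * (u * (u + 2 * r)) ^ p := by
  fun_prop

lemma polyPart_integrand_nonneg {p r u : ℝ} (hr : 0 ≤ r) (hu : 0 < u) :
    0 ≤ Real.exp (-u) * (u * (u + 2 * r)) ^ p := by positivity

lemma integrableOn_polyPart {p r : ℝ} (hp : 0 < p) (hr : 0 ≤ r) :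
    IntegrableOn (fun u : ℝ => Real.exp (-u) * (u * (u + 2 * r)) ^ p) (Ioi 0) := by
  obtain ⟨K, hK, h⟩ := polyPart_integrand_le hp
  refine (integrableOn_exp_neg_mul (b := 3 / 4) (by norm_num) (K * Real.exp (r / 2))).mono'
    (measurable_polyPart_integrand p r).aestronglyMeasurable ?_
  filter_upwards [ae_restrict_mem measurableSet_Ioi] with u hu
  rw [Real.norm_of_nonneg (polyPart_integrand_nonneg hr hu)]
  exact h r u hr hu

lemma polyPart_pos {p r : ℝ} (hp : 0 < p) (hr : 0 ≤ r) : 0 < polyPart p r := by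
  refine (setIntegral_pos_iff_support_of_nonneg_ae ?_ (integrableOn_polyPart hp hr)).2 ?_
  · filter_upwards [ae_restrict_mem measurableSet_Ioi] with u hu
    exact polyPart_integrand_nonneg hr hu
  · rw [inter_eq_right.2]
    · simp
    · intro u hu
      have hu : 0 < u := hu
      exact (by positivity : 0 < Real.exp (-u) * (u * (u + 2 * r)) ^ p).ne'

lemma profile_pos {p r : ℝ} (hp : 0 < p) (hr : 0 ≤ r) : 0 < profile p r :=
  mul_pos (Real.exp_pos _) (polyPart_pos hp hr)

lemma setIntegral_Ioi_comp_add (f : ℝ → ℝ) (d : ℝ) :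
    ∫ u in Ioi (0 : ℝ), f (u + d) = ∫ v in Ioi d, f v := by
  have := (measurePreserving_add_right volume d).setIntegral_preimage_emb
    (measurableEmbedding_addRight d) f (Ioi d)
  simpa using this

lemma integrableOn_Ioi_comp_add {f : ℝ → ℝ} {d : ℝ} (hf : IntegrableOn f (Ioi d)) :
    IntegrableOn (fun u => f (u + d)) (Ioi 0) := by
  have := ((measurePreserving_add_right volume d).integrableOn_comp_preimage
    (measurableEmbedding_addRight d) (f := f) (s := Ioi d)).2 hf
  simpa [Function.comp_def] using this

/-- With `v = u + r` the profile is `∫_r^∞ e^{-v} (v² - r²)^p dv`, where both the domain and the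
integrand shrink as `r` grows. -/
lemma profile_anti {p a b : ℝ} (hp : 0 < p) (ha : 0 ≤ a) (hab : a ≤ b) :
    profile p b ≤ profile p a := by
  have hb : 0 ≤ b := ha.trans hab
  set f : ℝ → ℝ := fun u => Real.exp (-u) * (u * (u + 2 * a)) ^ p with hf
  have hint : IntegrableOn f (Ioi 0) := integrableOn_polyPart hp ha
  have hint' : IntegrableOn f (Ioi (b - a)) := hint.mono_set (Ioi_subset_Ioi (by linarith))
  have h1 : polyPart p b ≤ ∫ u in Ioi (0 : ℝ), Real.exp (b - a) * f (u + (b - a)) := by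
    refine setIntegral_mono_on (integrableOn_polyPart hp hb)
      ((integrableOn_Ioi_comp_add hint').const_mul _) measurableSet_Ioi fun u hu => ?_
    have hu : 0 < u := hu
    have : Real.exp (b - a) * f (u + (b - a)) =
        Real.exp (-u) * ((u + (b - a)) * (u + (b - a) + 2 * a)) ^ p := by
      simp only [hf]
      rw [← mul_assoc, ← Real.exp_add]; congr 2; ring
    rw [this]
    refine mul_le_mul_of_nonneg_left (Real.rpow_le_rpow (by positivity) ?_ hp.le)
      (Real.exp_pos _).le
    nlinarith
  rw [integral_const_mul, setIntegral_Ioi_comp_add] at h1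
  have h2 : ∫ v in Ioi (b - a), f v ≤ polyPart p a := by
    refine setIntegral_mono_set hint ?_ (Ioi_subset_Ioi (by linarith)).eventuallyLE
    filter_upwards [ae_restrict_mem measurableSet_Ioi] with u hu
    exact polyPart_integrand_nonneg ha hu
  calc profile p b ≤ Real.exp (-b) * (Real.exp (b - a) * polyPart p a) := by
        unfold profile; gcongr; exact h1.trans (by gcongr)
    _ = profile p a := by
        rw [← mul_assoc, ← Real.exp_add, profile]; congr 2; ring

/-- The growth is at most polynomial because `u + 2b ≤ (b/a)(u + 2a)`; hence the factor `e^{-r}`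
governs ratios of `profile`. -/
lemma polyPart_le_rpow_mul {p a b : ℝ} (hp : 0 < p) (ha : 0 < a) (hab : a ≤ b) :
    polyPart p b ≤ (b / a) ^ p * polyPart p a := by
  have hb : 0 < b := ha.trans_le hab
  have h1 : 1 ≤ b / a := (one_le_div ha).2 hab
  unfold polyPart
  rw [← integral_const_mul]
  refine setIntegral_mono_on (integrableOn_polyPart hp hb.le)
    ((integrableOn_polyPart hp ha.le).const_mul _) measurableSet_Ioi fun u hu => ?_
  have hu : 0 < u := hu
  have : u + 2 * b ≤ b / a * (u + 2 * a) := by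
    have : b / a * (u + 2 * a) = b / a * u + 2 * b := by field_simp
    nlinarith
  calc Real.exp (-u) * (u * (u + 2 * b)) ^ p
      ≤ Real.exp (-u) * (b / a * (u * (u + 2 * a))) ^ p := by
        refine mul_le_mul_of_nonneg_left (Real.rpow_le_rpow (by positivity) ?_ hp.le)
          (Real.exp_pos _).le
        nlinarith
    _ = _ := by rw [Real.mul_rpow (by positivity) (by positivity)]; ring

lemma exists_profile_le_exp {p : ℝ} (hp : 0 < p) :
    ∃ K : ℝ, 0 < K ∧ ∀ r : ℝ, 0 ≤ r → profile p r ≤ K * Real.exp (-r / 2) := by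
  obtain ⟨K, hK, h⟩ := polyPart_integrand_le hp
  have hI : 0 ≤ ∫ u in Ioi (0 : ℝ), Real.exp (-(3 / 4) * u) :=
    integral_nonneg fun u => (Real.exp_pos _).le
  refine ⟨K * (∫ u in Ioi (0 : ℝ), Real.exp (-(3 / 4) * u)) + 1, by positivity, fun r hr => ?_⟩
  have h1 : polyPart p r ≤ K * Real.exp (r / 2) * ∫ u in Ioi (0 : ℝ), Real.exp (-(3 / 4) * u) := by
    rw [← integral_const_mul]
    exact setIntegral_mono_on (integrableOn_polyPart hp hr)
      (integrableOn_exp_neg_mul (by norm_num) _) measurableSet_Ioi fun u hu => h r u hr hu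
  calc profile p r ≤ Real.exp (-r) *
        (K * Real.exp (r / 2) * ∫ u in Ioi (0 : ℝ), Real.exp (-(3 / 4) * u)) := by
        unfold profile; gcongr
    _ = K * (∫ u in Ioi (0 : ℝ), Real.exp (-(3 / 4) * u)) * Real.exp (-r / 2) := by
        have : Real.exp (-r) * Real.exp (r / 2) = Real.exp (-r / 2) := by
          rw [← Real.exp_add]; congr 1; ring
        linear_combination K * (∫ u in Ioi (0 : ℝ), Real.exp (-(3 / 4) * u)) * this
    _ ≤ _ := by gcongr; linarith

lemma continuousOn_polyPart {p : ℝ} (hp : 0 < p) (R : ℝ) :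
    ContinuousOn (polyPart p) (Icc 0 R) := by
  obtain ⟨K, hK, h⟩ := polyPart_integrand_le hp
  refine continuousOn_of_dominated
    (bound := fun u => K * Real.exp (R / 2) * Real.exp (-(3 / 4) * u))
    (fun r _ => (measurable_polyPart_integrand p r).aestronglyMeasurable) (fun r hr => ?_)
    (integrableOn_exp_neg_mul (by norm_num) _) ?_
  · filter_upwards [ae_restrict_mem measurableSet_Ioi] with u hu
    rw [Real.norm_of_nonneg (polyPart_integrand_nonneg hr.1 hu)]
    refine (h r u hr.1 hu).trans ?_
    gcongr
    exact hr.2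
  · filter_upwards with u
    exact (continuous_const.mul ((by fun_prop : Continuous fun r : ℝ => u * (u + 2 * r)).rpow_const
      fun _ => Or.inr hp.le)).continuousOn

lemma continuous_profile_abs {p κ : ℝ} (hp : 0 < p) (hκ : 0 ≤ κ) :
    Continuous fun s : ℝ => profile p (κ * |s|) := by
  unfold profile
  refine Continuous.mul (by fun_prop) ?_
  rw [continuous_iff_continuousAt]
  intro s
  have h1 : ContinuousOn (fun s : ℝ => polyPart p (κ * |s|)) (Icc (s - 1) (s + 1)) := by
    refine (continuousOn_polyPart hp (κ * (|s| + 1))).comp (by fun_prop) fun t ht => ?_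
    refine ⟨by positivity, ?_⟩
    gcongr
    have := abs_sub_abs_le_abs_sub t s
    have h2 : |t - s| ≤ 1 := abs_le.2 ⟨by linarith [ht.1], by linarith [ht.2]⟩
    linarith
  exact h1.continuousAt (Icc_mem_nhds (by linarith) (by linarith))

lemma exists_hasDerivAt_polyPart {p r : ℝ} (hp : 0 < p) (hr : 0 < r) :
    ∃ d : ℝ, 0 ≤ d ∧ HasDerivAt (polyPart p) d r := by
  obtain ⟨K, hK, h⟩ := polyPart_integrand_le hp
  set F' : ℝ → ℝ → ℝ := fun r u =>
    Real.exp (-u) * (u * (u + 2 * r)) ^ p * (2 * p / (u + 2 * r)) with hF'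
  have key := hasDerivAt_integral_of_dominated_loc_of_deriv_le
    (μ := volume.restrict (Ioi (0 : ℝ))) (F := fun r u => Real.exp (-u) * (u * (u + 2 * r)) ^ p)
    (F' := F') (x₀ := r) (s := Ioo (r / 2) (2 * r))
    (bound := fun u => K * Real.exp r * (2 * p / r) * Real.exp (-(3 / 4) * u))
    (Ioo_mem_nhds (by linarith) (by linarith))
    (Eventually.of_forall fun r => (measurable_polyPart_integrand p r).aestronglyMeasurable)
    (integrableOn_polyPart hp hr.le)
    (by
      have : Measurable (F' r) := (measurable_polyPart_integrand p r).mul (by fun_prop)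
      exact this.aestronglyMeasurable)
    (by
      filter_upwards [ae_restrict_mem measurableSet_Ioi] with u hu x hx
      have hu : 0 < u := hu
      have hx0 : 0 < x := by linarith [hx.1]
      rw [Real.norm_of_nonneg (by positivity)]
      calc F' x u ≤ (K * Real.exp (x / 2) * Real.exp (-(3 / 4) * u)) * (2 * p / r) := by
            refine mul_le_mul (h x u hx0.le hu) ?_ (by positivity) (by positivity)
            exact div_le_div_of_nonneg_left (by positivity) hr (by linarith [hx.1])
        _ ≤ (K * Real.exp r * Real.exp (-(3 / 4) * u)) * (2 * p / r) := by
            gcongr; linarith [hx.2]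
        _ = _ := by ring)
    (integrableOn_exp_neg_mul (by norm_num) _)
    (by
      filter_upwards [ae_restrict_mem measurableSet_Ioi] with u hu x hx
      have hu : 0 < u := hu
      have hx0 : 0 < x := by linarith [hx.1]
      have h1 : HasDerivAt (fun x : ℝ => u * (u + 2 * x)) (u * 2) x := by
        simpa using (((hasDerivAt_id x).const_mul 2).const_add u).const_mul u
      have h2 := (h1.rpow_const (p := p) (Or.inl (by positivity))).const_mul (Real.exp (-u))
      refine h2.congr_deriv ?_
      simp only [hF']
      rw [Real.rpow_sub_one (by positivity)]
      field_simp)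
  refine ⟨_, ?_, key.2⟩
  refine setIntegral_nonneg measurableSet_Ioi fun u hu => ?_
  have hu : 0 < u := hu
  simp only [hF']
  positivity

/-- `F' ≥ -F` because `polyPart` is nondecreasing, and `F' ≤ 0` because `F` is decreasing. -/
lemma exists_hasDerivAt_profile {p r : ℝ} (hp : 0 < p) (hr : 0 < r) :
    ∃ d : ℝ, |d| ≤ profile p r ∧ HasDerivAt (profile p) d r := by
  obtain ⟨d, hd, h⟩ := exists_hasDerivAt_polyPart hp hr
  have h1 : HasDerivAt (profile p)
      (Real.exp (-r) * -1 * polyPart p r + Real.exp (-r) * d) r :=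
    ((hasDerivAt_neg r).exp).mul h
  refine ⟨_, abs_le.2 ⟨?_, ?_⟩, h1⟩
  · have : 0 ≤ Real.exp (-r) * d := by positivity
    unfold profile
    linarith
  · have hanti : AntitoneOn (profile p) (Ioi 0) := fun a ha b _ hab => profile_anti hp (le_of_lt ha) hab
    have h2 := hanti.derivWithin_nonpos (x := r)
    rw [(h1.hasDerivWithinAt (s := Ioi 0)).derivWithin (isOpen_Ioi.uniqueDiffWithinAt hr)] at h2
    exact h2.trans (profile_pos hp hr.le).le

lemma exists_profile_ratio_le {p : ℝ} (hp : 0 < p) : ∃ M : ℝ, 0 < M ∧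
    ∀ κ a b : ℝ, 4 ≤ κ → 0 < a → a ≤ 1 / 2 → 1 / 2 ≤ b →
      profile p (κ * b) ≤ M * Real.exp (-(κ * (b - a) / 4)) * profile p (κ * a) := by
  obtain ⟨K, hK, h⟩ := exists_rpow_le_exp (p := p) (ε := 1 / 2) hp (by norm_num)
  refine ⟨K * Real.exp 1, by positivity, fun κ a b hκ ha ha2 hb => ?_⟩
  -- The factor `(b/a)^p` blows up as `a → 0`, so the comparison is made at `a' = max(a, 1/4)`.
  -- Monotonicity of `profile` returns to `a`, and at most half of the gap `b - a` is lost.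
  obtain ⟨a', h1, h2, h3, h4⟩ : ∃ a', 1 / 4 ≤ a' ∧ a ≤ a' ∧ a' ≤ 1 / 2 ∧ (b - a) / 2 ≤ b - a' := by
    rcases le_total a (1 / 4) with h | h
    · exact ⟨1 / 4, by norm_num, h, by norm_num, by linarith⟩
    · exact ⟨a, h, le_rfl, ha2, by linarith⟩
  have ha0 : 0 < a' := by linarith
  have hb0 : 0 < b := by linarith
  have hκ0 : 0 < κ := by linarith
  have e1 : profile p (κ * a') ≤ profile p (κ * a) := profile_anti hp (by positivity) (by gcongr)
  have e2 : polyPart p (κ * b) ≤ (b / a') ^ p * polyPart p (κ * a') := by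
    have := polyPart_le_rpow_mul (p := p) hp (a := κ * a') (b := κ * b) (by positivity)
      (by gcongr; linarith)
    rwa [mul_div_mul_left _ _ hκ0.ne'] at this
  have e3 : (b / a') ^ p ≤ K * Real.exp (1 / 2 * (4 * b)) := by
    refine le_trans ?_ (h (4 * b) (by positivity))
    gcongr
    rw [div_le_iff₀ ha0]
    nlinarith
  -- Half of `κ(b - a')` pays for `κ(b - a)/4`; the other half is at least `2(b - a') ≥ 2b - 1`
  -- since `κ ≥ 4` and `a' ≤ 1/2`.
  have e4 : Real.exp (-(κ * b)) * Real.exp (1 / 2 * (4 * b)) ≤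
      Real.exp 1 * Real.exp (-(κ * (b - a) / 4)) * Real.exp (-(κ * a')) := by
    rw [← Real.exp_add, ← Real.exp_add, ← Real.exp_add, Real.exp_le_exp]
    nlinarith
  calc profile p (κ * b) ≤ Real.exp (-(κ * b)) *
        (K * Real.exp (1 / 2 * (4 * b)) * polyPart p (κ * a')) := by
        have := (polyPart_pos (p := p) (r := κ * a') hp (by positivity)).le
        unfold profile
        gcongr
        exact e2.trans (by gcongr)
    _ = K * polyPart p (κ * a') * (Real.exp (-(κ * b)) * Real.exp (1 / 2 * (4 * b))) := by ring
    _ ≤ K * polyPart p (κ * a') *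
        (Real.exp 1 * Real.exp (-(κ * (b - a) / 4)) * Real.exp (-(κ * a'))) := by
        have := (polyPart_pos (p := p) (r := κ * a') hp (by positivity)).le
        gcongr
    _ = K * Real.exp 1 * Real.exp (-(κ * (b - a) / 4)) * profile p (κ * a') := by
        unfold profile; ring
    _ ≤ _ := by gcongr

end Multiquadric

namespace Multiquadric

open Set Filter Topology

/-! ### The periodized quotient -/

/-- `|y|^{-σ} F(κ |y|)` with `F` the radial profile: the shape of `phiHat` in units of `2π`. -/
noncomputable def radial (σ p κ y : ℝ) : ℝ := |y| ^ (-σ) * profile p (κ * |y|)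

/-- `radial` multiplied by the `1`-periodic factor `|sin (π s) / π|^σ`, which removes the
singularity at the origin. -/
noncomputable def bump (σ p κ s : ℝ) : ℝ :=
  |Real.sinc (Real.pi * s)| ^ σ * profile p (κ * |s|)

/-- The continuous version of `fundamentalHat`, in units of `2π`. -/
noncomputable def cardinalHat (σ p κ s : ℝ) : ℝ :=
  bump σ p κ s / ∑' k : ℤ, bump σ p κ (s + k)

lemma summable_exp_neg_mul_abs_int {b : ℝ} (hb : 0 < b) :
    Summable fun k : ℤ => Real.exp (-(b * |(k : ℝ)|)) := by
  have h : Summable fun n : ℕ => Real.exp (-(b * |(n : ℝ)|)) := by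
    have := Real.summable_exp_nat_mul_iff.2 (neg_lt_zero.2 hb)
    refine this.congr fun n => ?_
    rw [Nat.abs_cast]; ring_nf
  refine Summable.of_nat_of_neg (by simpa using h) (by simpa using h)

lemma summable_exp_neg_abs_int : Summable fun k : ℤ => Real.exp (-|(k : ℝ)|) := by
  simpa using summable_exp_neg_mul_abs_int one_pos

lemma exp_neg_abs_add_le {R s : ℝ} (hs : |s| ≤ R) (k : ℤ) :
    Real.exp (-(2 * |s + k|)) ≤ Real.exp (2 * R) * Real.exp (-(2 * |(k : ℝ)|)) := by
  rw [← Real.exp_add, Real.exp_le_exp]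
  have := abs_sub_abs_le_abs_sub (k : ℝ) (-s)
  rw [abs_neg, sub_neg_eq_add, add_comm (k : ℝ)] at this
  linarith

variable {σ p κ : ℝ}

lemma bump_nonneg (hp : 0 < p) (hκ : 0 ≤ κ) (s : ℝ) : 0 ≤ bump σ p κ s :=
  mul_nonneg (by positivity) (profile_pos hp (by positivity)).le

lemma exists_profile_le_exp_two (hp : 0 < p) : ∃ K : ℝ, 0 < K ∧ ∀ κ s : ℝ, 4 ≤ κ →
    profile p (κ * |s|) ≤ K * Real.exp (-(2 * |s|)) := by
  obtain ⟨K, hK, h⟩ := exists_profile_le_exp hp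
  refine ⟨K, hK, fun κ s hκ => (h _ (by positivity)).trans ?_⟩
  gcongr
  nlinarith [abs_nonneg s]

lemma exists_bump_le (hσ : 0 ≤ σ) (hp : 0 < p) : ∃ K : ℝ, 0 < K ∧ ∀ κ s : ℝ, 4 ≤ κ →
    bump σ p κ s ≤ K * Real.exp (-(2 * |s|)) := by
  obtain ⟨K, hK, h⟩ := exists_profile_le_exp_two hp
  refine ⟨K, hK, fun κ s hκ => ?_⟩
  have h1 : |Real.sinc (Real.pi * s)| ^ σ ≤ 1 :=
    Real.rpow_le_one (abs_nonneg _) (Real.abs_sinc_le_one _) hσ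
  have h2 := (profile_pos (p := p) (r := κ * |s|) hp (by positivity)).le
  calc bump σ p κ s ≤ 1 * profile p (κ * |s|) := by unfold bump; gcongr
    _ ≤ _ := by rw [one_mul]; exact h κ s hκ

lemma continuous_bump (hσ : 0 ≤ σ) (hp : 0 < p) (hκ : 0 ≤ κ) : Continuous (bump σ p κ) := by
  unfold bump
  refine Continuous.mul ?_ (continuous_profile_abs hp hκ)
  exact (Real.continuous_sinc.comp (by fun_prop)).abs.rpow_const fun _ => Or.inr hσ

lemma summable_bump (hσ : 0 ≤ σ) (hp : 0 < p) (hκ : 4 ≤ κ) (s : ℝ) :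
    Summable fun k : ℤ => bump σ p κ (s + k) := by
  obtain ⟨K, hK, h⟩ := exists_bump_le hσ hp
  refine Summable.of_nonneg_of_le (fun k => bump_nonneg hp (by linarith) _)
    (fun k => (h κ _ hκ).trans (mul_le_mul_of_nonneg_left (exp_neg_abs_add_le le_rfl k) hK.le)) ?_
  exact ((summable_exp_neg_mul_abs_int two_pos).mul_left _).mul_left _

lemma continuous_tsum_bump (hσ : 0 ≤ σ) (hp : 0 < p) (hκ : 4 ≤ κ) :
    Continuous fun s : ℝ => ∑' k : ℤ, bump σ p κ (s + k) := by
  obtain ⟨K, hK, h⟩ := exists_bump_le hσ hp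
  rw [continuous_iff_continuousAt]
  intro s
  have h1 : ContinuousOn (fun s : ℝ => ∑' k : ℤ, bump σ p κ (s + k)) (Icc (s - 1) (s + 1)) := by
    refine continuousOn_tsum
      (u := fun k : ℤ => K * (Real.exp (2 * (|s| + 1)) * Real.exp (-(2 * |(k : ℝ)|))))
      (fun k => ((continuous_bump hσ hp (by linarith)).comp (by fun_prop)).continuousOn)
      (((summable_exp_neg_mul_abs_int two_pos).mul_left _).mul_left _) fun k t ht => ?_
    rw [Real.norm_of_nonneg (bump_nonneg hp (by linarith) _)]
    refine (h κ _ hκ).trans (mul_le_mul_of_nonneg_left (exp_neg_abs_add_le ?_ k) hK.le)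
    have := abs_sub_abs_le_abs_sub t s
    have h2 : |t - s| ≤ 1 := abs_le.2 ⟨by linarith [ht.1], by linarith [ht.2]⟩
    linarith
  exact h1.continuousAt (Icc_mem_nhds (by linarith) (by linarith))

lemma sin_pi_mul_ne_zero {s : ℝ} (hs : ∀ k : ℤ, s ≠ k) : Real.sin (Real.pi * s) ≠ 0 := by
  rw [Real.sin_ne_zero_iff]
  intro n hn
  refine hs n ?_
  rw [mul_comm] at hn
  exact (mul_left_cancel₀ Real.pi_ne_zero hn).symm

lemma bump_eq_radial {s : ℝ} (hs : s ≠ 0) :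
    bump σ p κ s = (|Real.sin (Real.pi * s)| / Real.pi) ^ σ * radial σ p κ s := by
  unfold bump radial
  rw [Real.sinc_of_ne_zero (by positivity), abs_div, abs_mul, abs_of_pos Real.pi_pos, ← div_div,
    Real.div_rpow (by positivity) (by positivity), Real.rpow_neg (by positivity)]
  ring

lemma abs_sin_pi_mul_add_int (s : ℝ) (k : ℤ) :
    |Real.sin (Real.pi * (s + k))| = |Real.sin (Real.pi * s)| := by
  rw [mul_add, mul_comm Real.pi (k : ℝ), Real.sin_add_int_mul_pi, abs_mul, abs_zpow]
  simp

lemma add_int_ne_zero {s : ℝ} (hs : ∀ k : ℤ, s ≠ k) (k : ℤ) : s + k ≠ 0 := fun h =>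
  hs (-k) (by push_cast; linarith)

lemma tsum_bump_pos (hσ : 0 ≤ σ) (hp : 0 < p) (hκ : 4 ≤ κ) (s : ℝ) :
    0 < ∑' k : ℤ, bump σ p κ (s + k) := by
  obtain ⟨k, hk⟩ : ∃ k : ℤ, 0 < bump σ p κ (s + k) := by
    by_cases h : ∀ k : ℤ, s ≠ k
    · refine ⟨0, ?_⟩
      have h0 : s ≠ 0 := by simpa using h 0
      have h1 := profile_pos (p := p) (r := κ * |s|) hp (by positivity)
      have h2 := abs_pos.2 (sin_pi_mul_ne_zero h)
      rw [Int.cast_zero, add_zero, bump_eq_radial h0, radial]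
      positivity
    -- At an integer, the translate landing on the origin contributes `F(0) > 0`.
    · push Not at h
      obtain ⟨k, hk⟩ := h
      refine ⟨-k, ?_⟩
      simp [hk, bump, profile_pos hp le_rfl]
  exact (summable_bump hσ hp hκ s).tsum_pos (fun k => bump_nonneg hp (by linarith) _) k hk

lemma continuous_cardinalHat (hσ : 0 ≤ σ) (hp : 0 < p) (hκ : 4 ≤ κ) :
    Continuous (cardinalHat σ p κ) :=
  (continuous_bump hσ hp (by linarith)).div (continuous_tsum_bump hσ hp hκ)
    fun s => (tsum_bump_pos hσ hp hκ s).ne'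

lemma radial_pos (hp : 0 < p) (hκ : 0 ≤ κ) {y : ℝ} (hy : y ≠ 0) : 0 < radial σ p κ y :=
  mul_pos (by positivity) (profile_pos hp (by positivity))

lemma radial_nonneg (hp : 0 < p) (hκ : 0 ≤ κ) (y : ℝ) : 0 ≤ radial σ p κ y :=
  mul_nonneg (by positivity) (profile_pos hp (by positivity)).le

lemma cardinalHat_eq_radial {s : ℝ} (hs : ∀ k : ℤ, s ≠ k) :
    cardinalHat σ p κ s = radial σ p κ s / ∑' k : ℤ, radial σ p κ (s + k) := by
  have h0 : s ≠ 0 := by simpa using hs 0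
  have h2 := abs_pos.2 (sin_pi_mul_ne_zero hs)
  have h : ∀ k : ℤ, bump σ p κ (s + k) =
      (|Real.sin (Real.pi * s)| / Real.pi) ^ σ * radial σ p κ (s + k) := fun k => by
    rw [bump_eq_radial (add_int_ne_zero hs k), abs_sin_pi_mul_add_int]
  unfold cardinalHat
  rw [bump_eq_radial h0, tsum_congr h, tsum_mul_left, mul_div_mul_left _ _ (by positivity)]

lemma summable_radial (hσ : 0 ≤ σ) (hp : 0 < p) (hκ : 4 ≤ κ) {s : ℝ} (hs : ∀ k : ℤ, s ≠ k) :
    Summable fun k : ℤ => radial σ p κ (s + k) := by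
  have h2 := abs_pos.2 (sin_pi_mul_ne_zero hs)
  have h3 : (|Real.sin (Real.pi * s)| / Real.pi) ^ σ ≠ 0 := by positivity
  refine (summable_mul_left_iff h3).1 ?_
  refine (summable_bump (σ := σ) hσ hp hκ s).congr fun k => ?_
  rw [bump_eq_radial (add_int_ne_zero hs k), abs_sin_pi_mul_add_int]

lemma tsum_radial_add_int (s : ℝ) (k : ℤ) :
    ∑' m : ℤ, radial σ p κ (s + k + m) = ∑' m : ℤ, radial σ p κ (s + m) := by
  rw [← (Equiv.addLeft k).tsum_eq fun m : ℤ => radial σ p κ (s + m)]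
  simp [add_assoc]

/-- The logarithmic derivative of the power contributes `σ/|y|`, that of the profile at most `κ`. -/
lemma exists_hasDerivAt_radial (hσ : 0 ≤ σ) (hp : 0 < p) (hκ : 0 < κ) {y : ℝ} (hy : y ≠ 0) :
    |deriv (radial σ p κ) y| ≤ (κ + σ / |y|) * radial σ p κ y ∧
      HasDerivAt (radial σ p κ) (deriv (radial σ p κ) y) y := by
  have hy' : 0 < |y| := abs_pos.2 hy
  obtain ⟨d, hd, h⟩ := exists_hasDerivAt_profile (p := p) (r := κ * |y|) hp (by positivity)
  have h1 : HasDerivAt (fun y : ℝ => |y|) (SignType.sign y : ℝ) y := hasDerivAt_abs hy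
  have h2 : HasDerivAt (fun y : ℝ => profile p (κ * |y|)) (d * (κ * (SignType.sign y : ℝ))) y :=
    HasDerivAt.comp (h₂ := profile p) (h := fun y : ℝ => κ * |y|) y h (h1.const_mul κ)
  have h3 := (h1.rpow_const (p := -σ) (Or.inl hy'.ne')).mul h2
  have h4 : HasDerivAt (radial σ p κ) _ y := h3
  have hs : |(SignType.sign y : ℝ)| ≤ 1 := by
    rcases lt_or_gt_of_ne hy with h | h <;> simp [h]
  have hF := (profile_pos (p := p) (r := κ * |y|) hp (by positivity))
  refine ⟨?_, h4.differentiableAt.hasDerivAt⟩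
  rw [h4.deriv]
  have e1 : |(SignType.sign y : ℝ) * -σ * |y| ^ (-σ - 1) * profile p (κ * |y|)| ≤
      1 * σ * |y| ^ (-σ - 1) * profile p (κ * |y|) := by
    rw [abs_mul, abs_mul, abs_mul, abs_neg, abs_of_nonneg hσ, abs_of_pos hF,
      abs_of_nonneg (by positivity : 0 ≤ |y| ^ (-σ - 1))]
    gcongr
  have e2 : |(|y| ^ (-σ) * (d * (κ * (SignType.sign y : ℝ))))| ≤
      |y| ^ (-σ) * (profile p (κ * |y|) * (κ * 1)) := by
    rw [abs_mul, abs_mul, abs_mul, abs_of_pos hκ,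
      abs_of_nonneg (by positivity : 0 ≤ |y| ^ (-σ))]
    gcongr
  refine (abs_add_le _ _).trans ((add_le_add e1 e2).trans (le_of_eq ?_))
  rw [Real.rpow_sub_one hy'.ne', radial]
  field_simp
  ring

end Multiquadric

namespace Multiquadric

open Set Filter Topology

/-! ### Dominance of the central translate and the derivative of the quotient -/

variable {σ p κ : ℝ}

/-- The boundary layer factor of width `1 / κ` at `s = ± 1/2`. -/
noncomputable def layer (κ s : ℝ) : ℝ := Real.exp (-(κ * (1 / 2 - |s|) / 2))

lemma layer_pos (κ s : ℝ) : 0 < layer κ s := Real.exp_pos _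

lemma layer_le_one (hκ : 0 ≤ κ) {s : ℝ} (hs : |s| ≤ 1 / 2) : layer κ s ≤ 1 := by
  unfold layer
  rw [Real.exp_le_one_iff]
  have : 0 ≤ κ * (1 / 2 - |s|) := mul_nonneg hκ (by linarith)
  linarith

lemma one_le_abs_int {k : ℤ} (hk : k ≠ 0) : 1 ≤ |(k : ℝ)| := by
  exact_mod_cast Int.one_le_abs hk

lemma abs_int_sub_le (s : ℝ) (k : ℤ) : |(k : ℝ)| - |s| ≤ |s + k| := by
  have := abs_sub_abs_le_abs_sub (k : ℝ) (-s)
  rwa [abs_neg, sub_neg_eq_add, add_comm (k : ℝ)] at this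

lemma ne_int_of_abs_lt {s : ℝ} (hs0 : s ≠ 0) (hs : |s| < 1) (k : ℤ) : s ≠ k := by
  rintro rfl
  have hk : k ≠ 0 := by rintro rfl; simp at hs0
  linarith [one_le_abs_int hk]

/-- Comparison of the translates of `radial` with the dominant one. -/
lemma exists_radial_ratio_le (hσ : σ = 0 ∨ 1 ≤ σ) (hp : 0 < p) : ∃ M : ℝ, 1 ≤ M ∧
    ∀ (κ s : ℝ) (k : ℤ), 4 ≤ κ → s ≠ 0 → |s| ≤ 1 / 2 → k ≠ 0 →
      radial σ p κ (s + k) ≤ M * Real.exp (-|(k : ℝ)|) * layer κ s * radial σ p κ s ∧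
      (κ + σ / |s|) * radial σ p κ (s + k) ≤
        (1 + σ) * κ * (M * Real.exp (-|(k : ℝ)|) * layer κ s * radial σ p κ s) := by
  obtain ⟨M, hM, h⟩ := exists_profile_ratio_le hp
  have hσ0 : 0 ≤ σ := by rcases hσ with h | h <;> linarith
  refine ⟨M * Real.exp 1 + 1, by linarith [mul_pos hM (Real.exp_pos 1)],
    fun κ s k hκ hs0 hs hk => ?_⟩
  have hk1 := one_le_abs_int hk
  have ha : 0 < |s| := abs_pos.2 hs0
  have hb' := abs_int_sub_le s k
  have hb : 1 / 2 ≤ |s + k| := by linarith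
  have hb0 : 0 < |s + k| := by linarith
  have hFa := profile_pos (p := p) (r := κ * |s|) hp (by positivity)
  have hFb := profile_pos (p := p) (r := κ * |s + k|) hp (by positivity)
  have hlay := layer_pos κ s
  have h1 : profile p (κ * |s + k|) ≤
      (M * Real.exp 1 + 1) * Real.exp (-|(k : ℝ)|) * layer κ s * profile p (κ * |s|) := by
    refine (h κ |s| |s + k| hκ ha hs hb).trans ?_
    -- Split `|k| - 2|s| = (|k| - 1) + 2(1/2 - |s|)`: the first part, with `κ ≥ 4`, gives `e^{1 -
    -- |k|}`, the second is the layer exponent.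
    have e : Real.exp (-(κ * (|s + k| - |s|) / 4)) ≤
        Real.exp 1 * Real.exp (-|(k : ℝ)|) * layer κ s := by
      unfold layer
      rw [← Real.exp_add, ← Real.exp_add, Real.exp_le_exp]
      nlinarith
    calc M * Real.exp (-(κ * (|s + k| - |s|) / 4)) * profile p (κ * |s|)
        ≤ M * (Real.exp 1 * Real.exp (-|(k : ℝ)|) * layer κ s) * profile p (κ * |s|) := by gcongr
      _ = (M * Real.exp 1) * (Real.exp (-|(k : ℝ)|) * layer κ s * profile p (κ * |s|)) := by ring
      _ ≤ (M * Real.exp 1 + 1) * (Real.exp (-|(k : ℝ)|) * layer κ s * profile p (κ * |s|)) := by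
        gcongr; linarith
      _ = _ := by ring
  have hab : |s| ≤ |s + k| := by linarith
  have hpow : |s + k| ^ (-σ) ≤ |s| ^ (-σ) :=
    Real.rpow_le_rpow_of_nonpos ha hab (by linarith)
  have hpow' : (κ + σ / |s|) * |s + k| ^ (-σ) ≤ (1 + σ) * κ * |s| ^ (-σ) := by
    -- The pole `σ/|s|` is absorbed by `|s|^{-σ}`: write both powers as exponent `-(σ - 1)` over the
    -- base and use `|s + k| ≥ 1/2`. Monotonicity needs `σ ≥ 1`; for `σ = 0` there is no pole.
    have h2 : σ / |s| * |s + k| ^ (-σ) ≤ 2 * σ * |s| ^ (-σ) := by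
      rcases hσ with rfl | hσ
      · simp
      · have e1 : |s + k| ^ (-σ) = |s + k| ^ (-(σ - 1)) / |s + k| := by
          rw [← Real.rpow_sub_one hb0.ne']; congr 1; ring
        have e2 : |s| ^ (-σ) = |s| ^ (-(σ - 1)) / |s| := by
          rw [← Real.rpow_sub_one ha.ne']; congr 1; ring
        have e3 : |s + k| ^ (-(σ - 1)) ≤ |s| ^ (-(σ - 1)) :=
          Real.rpow_le_rpow_of_nonpos ha hab (by linarith)
        calc σ / |s| * |s + k| ^ (-σ) = σ * (|s + k| ^ (-(σ - 1)) / |s|) * (1 / |s + k|) := by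
              rw [e1]; field_simp
          _ ≤ σ * (|s| ^ (-(σ - 1)) / |s|) * 2 := by
              gcongr
              rw [div_le_iff₀ hb0]; linarith
          _ = _ := by rw [e2]; ring
    have h3 : κ * |s + k| ^ (-σ) ≤ κ * |s| ^ (-σ) := by gcongr
    have h4 : 0 < |s| ^ (-σ) := by positivity
    have h5 : 2 * σ * |s| ^ (-σ) ≤ κ * σ * |s| ^ (-σ) := by gcongr; linarith
    nlinarith
  constructor
  · calc radial σ p κ (s + k) ≤ |s| ^ (-σ) *
          ((M * Real.exp 1 + 1) * Real.exp (-|(k : ℝ)|) * layer κ s * profile p (κ * |s|)) := by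
          unfold radial; gcongr
      _ = _ := by unfold radial; ring
  · calc (κ + σ / |s|) * radial σ p κ (s + k)
        = ((κ + σ / |s|) * |s + k| ^ (-σ)) * profile p (κ * |s + k|) := by unfold radial; ring
      _ ≤ ((1 + σ) * κ * |s| ^ (-σ)) *
          ((M * Real.exp 1 + 1) * Real.exp (-|(k : ℝ)|) * layer κ s * profile p (κ * |s|)) := by
          gcongr
      _ = _ := by unfold radial; ring

lemma abs_deriv_radial_le_far (hσ : 0 ≤ σ) (hp : 0 < p) (hκ : 4 ≤ κ) {y : ℝ} (hy : 1 / 2 ≤ |y|) :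
    |deriv (radial σ p κ) y| ≤ (1 + σ) * κ * radial σ p κ y := by
  have hy0 : 0 < |y| := by linarith
  refine (exists_hasDerivAt_radial hσ hp (by linarith) (abs_pos.1 hy0)).1.trans ?_
  refine mul_le_mul_of_nonneg_right ?_ (radial_nonneg hp (by linarith) y)
  have : σ / |y| ≤ 2 * σ := by rw [div_le_iff₀ hy0]; nlinarith
  nlinarith

/-- The Wronskian-type bound from which the derivative of the quotient is controlled. -/
lemma exists_radial_cross_le (hσ : σ = 0 ∨ 1 ≤ σ) (hp : 0 < p) : ∃ C : ℝ, 0 < C ∧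
    ∀ (κ s : ℝ) (k m : ℤ), 4 ≤ κ → s ≠ 0 → |s| ≤ 1 / 2 →
      |deriv (radial σ p κ) (s + k) * radial σ p κ (s + m) -
        radial σ p κ (s + k) * deriv (radial σ p κ) (s + m)| ≤
      C * κ * (Real.exp (-|(k : ℝ)|) * Real.exp (-|(m : ℝ)|)) * layer κ s *
        radial σ p κ s ^ 2 := by
  have hσ0 : 0 ≤ σ := by rcases hσ with h | h <;> linarith
  obtain ⟨M, hM, h⟩ := exists_radial_ratio_le hσ hp
  refine ⟨2 * (1 + σ) * M ^ 2, by positivity, ?_⟩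
  intro κ s k m hκ hs0 hs
  have hκ0 : 0 < κ := by linarith
  have g0 := radial_pos (σ := σ) hp hκ0.le hs0
  have hlay := layer_pos κ s
  have hlay1 := layer_le_one hκ0.le hs
  have hfar : ∀ k : ℤ, k ≠ 0 → 1 / 2 ≤ |s + k| := fun k hk => by
    linarith [one_le_abs_int hk, abs_int_sub_le s k]
  -- the case where one index vanishes
  have case0 : ∀ m : ℤ, m ≠ 0 →
      |deriv (radial σ p κ) s * radial σ p κ (s + m)| +
        |radial σ p κ s * deriv (radial σ p κ) (s + m)| ≤
      2 * (1 + σ) * M ^ 2 * κ * Real.exp (-|(m : ℝ)|) * layer κ s * radial σ p κ s ^ 2 := by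
    intro m hm
    obtain ⟨r1, r2⟩ := h κ s m hκ hs0 hs hm
    have gm := radial_nonneg (σ := σ) hp hκ0.le (s + m)
    have d0 := (exists_hasDerivAt_radial hσ0 hp hκ0 hs0).1
    have dm := abs_deriv_radial_le_far hσ0 hp hκ (hfar m hm)
    rw [abs_mul, abs_mul, abs_of_nonneg gm, abs_of_pos g0]
    have t1 : |deriv (radial σ p κ) s| * radial σ p κ (s + m) ≤
        (1 + σ) * κ * (M * Real.exp (-|(m : ℝ)|) * layer κ s * radial σ p κ s) *
          radial σ p κ s :=
      calc _ ≤ ((κ + σ / |s|) * radial σ p κ s) * radial σ p κ (s + m) := by gcongr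
        _ = ((κ + σ / |s|) * radial σ p κ (s + m)) * radial σ p κ s := by ring
        _ ≤ _ := by gcongr
    have t2 : radial σ p κ s * |deriv (radial σ p κ) (s + m)| ≤ radial σ p κ s *
        ((1 + σ) * κ * (M * Real.exp (-|(m : ℝ)|) * layer κ s * radial σ p κ s)) := by
      gcongr
      exact dm.trans (by gcongr)
    calc _ ≤ _ := add_le_add t1 t2
      _ = 2 * (1 + σ) * M * κ * Real.exp (-|(m : ℝ)|) * layer κ s * radial σ p κ s ^ 2 := by ring
      _ ≤ _ := by gcongr; nlinarith
  by_cases hk : k = 0 <;> by_cases hm : m = 0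
  -- The only pair without a small factor contributes exactly zero.
  · subst hk; subst hm
    rw [mul_comm (radial _ _ _ _), sub_self, abs_zero]
    positivity
  · subst hk
    refine (abs_sub _ _).trans ((le_of_eq ?_).trans ((case0 m hm).trans (le_of_eq ?_)))
    · simp
    · simp
  · subst hm
    rw [abs_sub_comm]
    refine (abs_sub _ _).trans ((le_of_eq ?_).trans ((case0 k hk).trans (le_of_eq ?_)))
    · simp [mul_comm, add_comm]
    · simp
  · have gk := radial_nonneg (σ := σ) hp hκ0.le (s + k)
    have gm := radial_nonneg (σ := σ) hp hκ0.le (s + m)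
    have dk := abs_deriv_radial_le_far hσ0 hp hκ (hfar k hk)
    have dm := abs_deriv_radial_le_far hσ0 hp hκ (hfar m hm)
    have rk := (h κ s k hκ hs0 hs hk).1
    have rm := (h κ s m hκ hs0 hs hm).1
    calc _ ≤ _ := abs_sub _ _
      _ ≤ ((1 + σ) * κ * radial σ p κ (s + k)) * radial σ p κ (s + m) +
          radial σ p κ (s + k) * ((1 + σ) * κ * radial σ p κ (s + m)) := by
        rw [abs_mul, abs_mul, abs_of_nonneg gk, abs_of_nonneg gm]
        gcongr
      _ = 2 * (1 + σ) * κ * (radial σ p κ (s + k) * radial σ p κ (s + m)) := by ring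
      -- Two layer factors are available here; one suffices, the other is bounded by 1.
      _ ≤ 2 * (1 + σ) * κ * ((M * Real.exp (-|(k : ℝ)|) * layer κ s * radial σ p κ s) *
          (M * Real.exp (-|(m : ℝ)|) * 1 * radial σ p κ s)) := by
        gcongr
        exact rm.trans (by gcongr)
      _ = _ := by ring

/-- The periodic denominator is at least its central term, so the ratio bounds pass to the quotient.
-/
lemma exists_cardinalHat_le (hσ : σ = 0 ∨ 1 ≤ σ) (hp : 0 < p) : ∃ M : ℝ, 0 < M ∧
    ∀ (κ s : ℝ) (k : ℤ), 4 ≤ κ → s ≠ 0 → |s| ≤ 1 / 2 →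
      |cardinalHat σ p κ (s + k)| ≤ M * Real.exp (-|(k : ℝ)|) := by
  have hσ0 : 0 ≤ σ := by rcases hσ with h | h <;> linarith
  obtain ⟨M, hM, h⟩ := exists_radial_ratio_le hσ hp
  refine ⟨M, by linarith, fun κ s k hκ hs0 hs => ?_⟩
  have hκ0 : 0 < κ := by linarith
  have hs' := ne_int_of_abs_lt hs0 (by linarith)
  have hsk : ∀ m : ℤ, s + k ≠ m := fun m hm => hs' (m - k) (by push_cast; linarith)
  have g0 := radial_pos (σ := σ) hp hκ0.le hs0
  have gk := radial_nonneg (σ := σ) hp hκ0.le (s + k)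
  have hD : radial σ p κ s ≤ ∑' m : ℤ, radial σ p κ (s + m) := by
    simpa using (summable_radial (σ := σ) hσ0 hp hκ hs').le_tsum (0 : ℤ)
      fun m _ => radial_nonneg hp hκ0.le _
  rw [cardinalHat_eq_radial hsk, tsum_radial_add_int,
    abs_of_nonneg (div_nonneg gk (g0.le.trans hD)), div_le_iff₀ (g0.trans_le hD)]
  refine le_trans ?_ (mul_le_mul_of_nonneg_left hD (by positivity))
  by_cases hk : k = 0
  · subst hk
    simp only [Int.cast_zero, add_zero, abs_zero, neg_zero, Real.exp_zero, mul_one]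
    nlinarith
  · refine ((h κ s k hκ hs0 hs hk).1).trans ?_
    have := layer_le_one hκ0.le hs
    refine mul_le_mul_of_nonneg_right (mul_le_of_le_one_right (by positivity) this) g0.le

lemma hasDerivAt_tsum_radial (hσ : 0 ≤ σ) (hp : 0 < p) (hκ : 4 ≤ κ) {s : ℝ} (hs0 : s ≠ 0)
    (hs : |s| < 1 / 2) :
    (Summable fun m : ℤ => deriv (radial σ p κ) (s + m)) ∧
    HasDerivAt (fun y => ∑' m : ℤ, radial σ p κ (y + m))
      (∑' m : ℤ, deriv (radial σ p κ) (s + m)) s := by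
  have hκ0 : 0 < κ := by linarith
  obtain ⟨K, hK, hF⟩ := exists_profile_le_exp_two hp
  -- On this ball every `y + m` stays at distance at least `ε` from the singularity, so one summable
  -- bound controls all derivatives.
  set ε := |s| / 2 with hε
  have hε0 : 0 < ε := by have := abs_pos.2 hs0; positivity
  set u : ℤ → ℝ := fun m =>
    (κ + σ / ε) * (ε ^ (-σ) * (K * (Real.exp (2 * 1) * Real.exp (-(2 * |(m : ℝ)|))))) with hu
  have hsum : Summable u :=
    ((((summable_exp_neg_mul_abs_int two_pos).mul_left _).mul_left _).mul_left _).mul_left _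
  have hball : ∀ y ∈ Metric.ball s ε, |y| ≤ 1 ∧ ∀ m : ℤ, ε ≤ |y + m| := by
    intro y hy
    rw [Metric.mem_ball, Real.dist_eq] at hy
    have h1 := abs_sub_abs_le_abs_sub y s
    have h2 := abs_sub_abs_le_abs_sub s y
    rw [abs_sub_comm s y] at h2
    refine ⟨by linarith, fun m => ?_⟩
    by_cases hm : m = 0
    · subst hm; simp only [Int.cast_zero, add_zero]; linarith
    · linarith [one_le_abs_int hm, abs_int_sub_le y m]
  have hne : ∀ y ∈ Metric.ball s ε, ∀ m : ℤ, y + m ≠ 0 := fun y hy m =>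
    abs_pos.1 (hε0.trans_le ((hball y hy).2 m))
  have hbd : ∀ (m : ℤ), ∀ y ∈ Metric.ball s ε, ‖deriv (radial σ p κ) (y + m)‖ ≤ u m := by
    intro m y hy
    have hεm := (hball y hy).2 m
    refine (exists_hasDerivAt_radial hσ hp hκ0 (hne y hy m)).1.trans ?_
    have e2 := (hF κ (y + m) hκ).trans
      (mul_le_mul_of_nonneg_left (exp_neg_abs_add_le (hball y hy).1 m) hK.le)
    have e3 := (profile_pos (p := p) (r := κ * |y + m|) hp (by positivity)).le
    have e4 : |y + m| ^ (-σ) ≤ ε ^ (-σ) := Real.rpow_le_rpow_of_nonpos hε0 hεm (by linarith)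
    unfold radial
    simp only [hu]
    gcongr
  have hmem : s ∈ Metric.ball s ε := Metric.mem_ball_self hε0
  refine ⟨Summable.of_norm_bounded hsum fun m => hbd m s hmem, ?_⟩
  refine hasDerivAt_tsum_of_isPreconnected (t := Metric.ball s ε) (y₀ := s) hsum
    Metric.isOpen_ball (convex_ball s ε).isPreconnected (fun m y hy => ?_) hbd hmem
    (summable_radial hσ hp hκ (ne_int_of_abs_lt hs0 (by linarith))) hmem
  exact (exists_hasDerivAt_radial hσ hp hκ0 (hne y hy m)).2.comp_add_const y (m : ℝ)

/-- The numerator of the quotient rule is a sum of the cross terms of `exists_radial_cross_le`, each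
`O(g(s)²)`, and the denominator `D²` is at least `g(s)²`. -/
lemma exists_deriv_cardinalHat_le (hσ : σ = 0 ∨ 1 ≤ σ) (hp : 0 < p) : ∃ C : ℝ, 0 < C ∧
    ∀ (κ s : ℝ) (k : ℤ), 4 ≤ κ → s ≠ 0 → |s| < 1 / 2 →
      DifferentiableAt ℝ (cardinalHat σ p κ) (s + k) ∧
      |deriv (cardinalHat σ p κ) (s + k)| ≤ C * κ * Real.exp (-|(k : ℝ)|) * layer κ s := by
  have hσ0 : 0 ≤ σ := by rcases hσ with h | h <;> linarith
  obtain ⟨C, hC, h⟩ := exists_radial_cross_le hσ hp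
  set S : ℝ := ∑' m : ℤ, Real.exp (-|(m : ℝ)|) with hS
  have hS0 : 0 < S := summable_exp_neg_abs_int.tsum_pos (fun m => (Real.exp_pos _).le) 0
    (Real.exp_pos _)
  refine ⟨C * S, by positivity, fun κ s k hκ hs0 hs => ?_⟩
  have hκ0 : 0 < κ := by linarith
  have hs' := ne_int_of_abs_lt hs0 (by linarith)
  have g0 := radial_pos (σ := σ) hp hκ0.le hs0
  have hlay := layer_pos κ s
  set D : ℝ := ∑' m : ℤ, radial σ p κ (s + m) with hDdef
  have hsumD := summable_radial (σ := σ) hσ0 hp hκ hs'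
  have hD : radial σ p κ s ≤ D := by
    simpa using hsumD.le_tsum (0 : ℤ) fun m _ => radial_nonneg hp hκ0.le _
  have hD0 : 0 < D := g0.trans_le hD
  obtain ⟨hsumD', hderD⟩ := hasDerivAt_tsum_radial (σ := σ) hσ0 hp hκ hs0 hs
  set D' : ℝ := ∑' m : ℤ, deriv (radial σ p κ) (s + m) with hD'
  have hk := (exists_hasDerivAt_radial hσ0 hp hκ0 (add_int_ne_zero hs' k)).2.comp_add_const s
    (k : ℝ)
  have hq : HasDerivAt (fun y => cardinalHat σ p κ (y + k))
      ((deriv (radial σ p κ) (s + k) * D - radial σ p κ (s + k) * D') / D ^ 2) s := by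
    refine (hk.div hderD hD0.ne').congr_of_eventuallyEq ?_
    have hopen : {y : ℝ | y ≠ 0 ∧ |y| < 1 / 2} ∈ 𝓝 s :=
      ((isOpen_ne.inter (isOpen_lt continuous_abs continuous_const)).mem_nhds ⟨hs0, hs⟩)
    filter_upwards [hopen] with y hy
    have hy' := ne_int_of_abs_lt hy.1 (by linarith [hy.2])
    have hyk : ∀ m : ℤ, y + k ≠ m := fun m hm => hy' (m - k) (by push_cast; linarith)
    rw [cardinalHat_eq_radial hyk, tsum_radial_add_int]
    rfl
  have hq' : HasDerivAt (cardinalHat σ p κ)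
      ((deriv (radial σ p κ) (s + k) * D - radial σ p κ (s + k) * D') / D ^ 2) (s + k) := by
    have h1 : HasDerivAt (fun y => cardinalHat σ p κ (y + k))
      ((deriv (radial σ p κ) (s + k) * D - radial σ p κ (s + k) * D') / D ^ 2) (s + k - k) := by
      simpa using hq
    simpa using h1.comp_sub_const (s + k) (k : ℝ)
  refine ⟨hq'.differentiableAt, ?_⟩
  rw [hq'.deriv, abs_div, abs_of_pos (by positivity : 0 < D ^ 2), div_le_iff₀ (by positivity)]
  have hnum : deriv (radial σ p κ) (s + k) * D - radial σ p κ (s + k) * D' =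
      ∑' m : ℤ, (deriv (radial σ p κ) (s + k) * radial σ p κ (s + m) -
        radial σ p κ (s + k) * deriv (radial σ p κ) (s + m)) := by
    rw [(hsumD.mul_left _).tsum_sub (hsumD'.mul_left _), tsum_mul_left, tsum_mul_left]
  have hbound : HasSum (fun m : ℤ => C * κ * (Real.exp (-|(k : ℝ)|) * Real.exp (-|(m : ℝ)|)) *
      layer κ s * radial σ p κ s ^ 2)
      (C * κ * (Real.exp (-|(k : ℝ)|) * S) * layer κ s * radial σ p κ s ^ 2) :=
    ((((summable_exp_neg_abs_int.hasSum).mul_left _).mul_left _).mul_right _).mul_right _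
  rw [hnum]
  have hle := tsum_of_norm_bounded hbound (f := fun m : ℤ =>
    deriv (radial σ p κ) (s + k) * radial σ p κ (s + m) -
      radial σ p κ (s + k) * deriv (radial σ p κ) (s + m)) fun m => h κ s k m hκ hs0 hs.le
  refine hle.trans ?_
  calc C * κ * (Real.exp (-|(k : ℝ)|) * S) * layer κ s * radial σ p κ s ^ 2
      ≤ C * κ * (Real.exp (-|(k : ℝ)|) * S) * layer κ s * D ^ 2 := by gcongr
    _ = _ := by ring

end Multiquadric

namespace Multiquadric

open Set Filter Topology

/-! ### Summing the decay of a kernel over a translate of the integers -/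

/-- The majorant of a kernel at distance at least `n` from the origin. -/
noncomputable def majorant (B κ : ℝ) (n : ℕ) : ℝ :=
  if n = 0 then B else if n ≤ ⌊κ⌋₊ then B * (n : ℝ)⁻¹ else κ * ((n : ℝ) ^ 2)⁻¹

lemma majorant_nonneg {B κ : ℝ} (hB : 0 ≤ B) (hκ : 1 ≤ κ) (n : ℕ) : 0 ≤ majorant B κ n := by
  unfold majorant
  split_ifs <;> positivity

/-- The middle range is a harmonic sum up to `⌊κ⌋`; the tail is at most `κ/⌊κ⌋ ≤ 2`. -/
lemma sum_majorant_le {B κ : ℝ} (hB : 0 ≤ B) (hκ : 1 ≤ κ) (N : ℕ) :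
    ∑ n ∈ Finset.range N, majorant B κ n ≤ B + B * (1 + Real.log κ) + 2 := by
  set K := ⌊κ⌋₊ with hK
  have hK1 : 1 ≤ K := Nat.le_floor (by simpa using hκ)
  have hK1' : (1 : ℝ) ≤ K := by exact_mod_cast hK1
  have hKκ : κ ≤ 2 * K := by
    have := Nat.lt_floor_add_one κ
    rw [← hK] at this
    linarith
  have h1 : ∑ n ∈ Finset.range (K + 1), majorant B κ n ≤ B + B * (1 + Real.log κ) := by
    rw [Finset.sum_range_succ', add_comm]
    have e : ∑ n ∈ Finset.range K, majorant B κ (n + 1) = B * (harmonic K : ℝ) := by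
      rw [harmonic, Rat.cast_sum, Finset.mul_sum]
      refine Finset.sum_congr rfl fun n hn => ?_
      have : n + 1 ≤ ⌊κ⌋₊ := Finset.mem_range.1 hn
      simp [majorant, this]
    rw [e]
    have e0 : majorant B κ 0 = B := by simp [majorant]
    rw [e0]
    gcongr
    exact harmonic_floor_le_one_add_log κ hκ
  have h2 : ∑ n ∈ Finset.Ico (K + 1) (K + 1 + N), majorant B κ n ≤ 2 := by
    have e : ∑ n ∈ Finset.Ico (K + 1) (K + 1 + N), majorant B κ n =
        κ * ∑ n ∈ Finset.Ioc K (K + N), ((n : ℝ) ^ 2)⁻¹ := by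
      rw [Finset.mul_sum]
      refine Finset.sum_congr ?_ fun n hn => ?_
      · ext n; simp only [Finset.mem_Ico, Finset.mem_Ioc]; omega
      · have hn := (Finset.mem_Ioc.1 hn).1
        have h0 : n ≠ 0 := by omega
        have h1 : ¬ n ≤ ⌊κ⌋₊ := by omega
        simp [majorant, h0, h1]
    rw [e]
    have h3 := sum_Ioc_inv_sq_le_sub (α := ℝ) (k := K) (n := K + N) (by omega) (by omega)
    calc _ ≤ κ * ((K : ℝ)⁻¹ - ((K + N : ℕ) : ℝ)⁻¹) := by gcongr
      _ ≤ (2 * K) * (K : ℝ)⁻¹ := by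
        have : 0 ≤ ((K + N : ℕ) : ℝ)⁻¹ := by positivity
        have h4 : 0 ≤ (K : ℝ)⁻¹ := by positivity
        have h5 : (K : ℝ)⁻¹ - ((K + N : ℕ) : ℝ)⁻¹ ≤ (K : ℝ)⁻¹ := by linarith
        exact (mul_le_mul_of_nonneg_left h5 (by linarith)).trans
          (mul_le_mul_of_nonneg_right hKκ h4)
      _ = 2 := by field_simp
  calc ∑ n ∈ Finset.range N, majorant B κ n
      ≤ ∑ n ∈ Finset.range (K + 1 + N), majorant B κ n :=
        Finset.sum_le_sum_of_subset_of_nonneg (Finset.range_mono (by omega))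
          fun n _ _ => majorant_nonneg hB hκ n
    _ = _ := (Finset.sum_range_add_sum_Ico _ (by omega)).symm
    _ ≤ _ := add_le_add h1 h2

lemma le_sq_add_majorant {B κ w y : ℝ} (hκ : 1 ≤ κ) (hw : 0 ≤ w) (hwB : w ≤ B) (hyw : |y| * w ≤ B)
    {n : ℕ} (hn : (n : ℝ) ≤ |y|) : w ≤ y ^ 2 * w ^ 2 / κ + majorant B κ n := by
  have h0 : 0 ≤ y ^ 2 * w ^ 2 / κ := by positivity
  unfold majorant
  split_ifs with h1 h2
  · linarith
  · have hn0 : 0 < (n : ℝ) := by positivity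
    have : w ≤ B * (n : ℝ)⁻¹ := by
      rw [← div_eq_mul_inv, le_div_iff₀ hn0]
      nlinarith
    linarith
  · have hn0 : 0 < (n : ℝ) := by positivity
    have hy : 0 < y ^ 2 := by rw [← sq_abs]; have := hn0.trans_le hn; positivity
    have h3 : κ / y ^ 2 ≤ κ * ((n : ℝ) ^ 2)⁻¹ := by
      rw [div_eq_mul_inv, ← sq_abs y]
      gcongr
    have hy0 : y ≠ 0 := by rintro rfl; simp at hy
    -- Weighted AM-GM: with `X = y² w / κ` this is `(X² - X + 1) κ / y²`.
    have h4 : y ^ 2 * w ^ 2 / κ + κ / y ^ 2 - w =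
        ((y ^ 2 * w / κ - 1 / 2) ^ 2 + 3 / 4) * (κ / y ^ 2) := by
      field_simp
      ring
    have h5 : 0 ≤ ((y ^ 2 * w / κ - 1 / 2) ^ 2 + 3 / 4) * (κ / y ^ 2) := by positivity
    linarith

lemma summable_and_tsum_le_of_mem_Ico {w : ℝ → ℝ} {B κ x : ℝ} (hκ : 1 ≤ κ) (hw : ∀ y, 0 ≤ w y)
    (hwB : ∀ y, w y ≤ B) (hyw : ∀ y, |y| * w y ≤ B)
    (hs : Summable fun j : ℤ => (x + j) ^ 2 * w (x + j) ^ 2)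
    (hs' : ∑' j : ℤ, (x + j) ^ 2 * w (x + j) ^ 2 ≤ B * κ) (hx : x ∈ Ico (0 : ℝ) 1) :
    Summable (fun j : ℤ => w (x + j)) ∧
      ∑' j : ℤ, w (x + j) ≤ (4 + 5 * B) * (1 + Real.log κ) := by
  have hB : 0 ≤ B := (hw 0).trans (hwB 0)
  have hκ0 : 0 < κ := by linarith
  have hlog : 0 ≤ Real.log κ := Real.log_nonneg hκ
  set r : ℕ → ℝ := majorant B κ with hr
  have hrs : Summable r := summable_of_sum_range_le (majorant_nonneg hB hκ) (sum_majorant_le hB hκ)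
  have hrt : ∑' n, r n ≤ B + B * (1 + Real.log κ) + 2 :=
    Real.tsum_le_of_sum_range_le (majorant_nonneg hB hκ) (sum_majorant_le hB hκ)
  -- For `x ∈ [0, 1)` both `j = n` and `j = -(n + 1)` give `|x + j| ≥ n`, so each `majorant B κ n`
  -- is used twice.
  set R : ℤ → ℝ := fun j => Int.rec r r j with hR
  have hRs : Summable R := Summable.of_nat_of_neg_add_one hrs hrs
  have hRt : ∑' j, R j = ∑' n, r n + ∑' n, r n := tsum_of_nat_of_neg_add_one hrs hrs
  have hbound : ∀ j : ℤ, w (x + j) ≤ (x + j) ^ 2 * w (x + j) ^ 2 / κ + R j := by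
    rintro (n | n)
    · refine le_sq_add_majorant hκ (hw _) (hwB _) (hyw _) ?_
      have h : (0 : ℝ) ≤ x := hx.1
      have : (n : ℝ) ≤ x + ((Int.ofNat n : ℤ) : ℝ) := by simp [h]
      exact this.trans (le_abs_self _)
    · refine le_sq_add_majorant hκ (hw _) (hwB _) (hyw _) ?_
      have h : x < 1 := hx.2
      have : (n : ℝ) ≤ -(x + ((Int.negSucc n : ℤ) : ℝ)) := by
        rw [Int.cast_negSucc]; push_cast; linarith
      exact this.trans (neg_le_abs _)
  have hsum := (hs.div_const κ).add hRs
  have hS := Summable.of_nonneg_of_le (fun j => hw _) hbound hsum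
  refine ⟨hS, (hS.tsum_le_tsum hbound hsum).trans ?_⟩
  rw [(hs.div_const κ).tsum_add hRs, tsum_div_const, hRt]
  have : (∑' j : ℤ, (x + j) ^ 2 * w (x + j) ^ 2) / κ ≤ B := (div_le_iff₀ hκ0).2 hs'
  nlinarith

/-- A kernel bounded by `min (1, 1/|y|)` whose weighted square sums are `O(κ)` has Lebesgue
function `O(1 + log κ)`. -/
lemma summable_and_tsum_le {w : ℝ → ℝ} {B κ : ℝ} (hκ : 1 ≤ κ) (hw : ∀ y, 0 ≤ w y)
    (hwB : ∀ y, w y ≤ B) (hyw : ∀ y, |y| * w y ≤ B)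
    (hs : ∀ x : ℝ, Summable (fun j : ℤ => (x + j) ^ 2 * w (x + j) ^ 2) ∧
      ∑' j : ℤ, (x + j) ^ 2 * w (x + j) ^ 2 ≤ B * κ) (x : ℝ) :
    Summable (fun j : ℤ => w (x + j)) ∧
      ∑' j : ℤ, w (x + j) ≤ (4 + 5 * B) * (1 + Real.log κ) := by
  have h := summable_and_tsum_le_of_mem_Ico hκ hw hwB hyw (hs (Int.fract x)).1 (hs _).2
    ⟨Int.fract_nonneg x, Int.fract_lt_one x⟩
  have e : (fun j : ℤ => w (x + j)) =
      (fun j : ℤ => w (Int.fract x + j)) ∘ Equiv.addLeft ⌊x⌋ := by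
    ext j
    simp only [Function.comp, Equiv.coe_addLeft, Int.cast_add]
    congr 1
    rw [← add_assoc, Int.fract_add_floor]
  rw [e]
  exact ⟨(Equiv.summable_iff _).2 h.1, (Equiv.tsum_eq (Equiv.addLeft ⌊x⌋)
    (fun j : ℤ => w (Int.fract x + j))).trans_le h.2⟩

/-! ### Periodization -/

/-- The points excluded from the bound are null; they are where derivative bounds may fail for the
functions used below. -/
lemma hasSum_integral_periodization {f : ℝ → ℂ} {b : ℝ → ℝ} (hf : Measurable f)
    (hb : IntervalIntegrable b volume (-1 / 2) (1 / 2))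
    (h : ∀ (s : ℝ) (k : ℤ), s ≠ 0 → |s| < 1 / 2 → ‖f (s + k)‖ ≤ Real.exp (-|(k : ℝ)|) * b s) :
    Integrable f ∧
      ∫ s, f s = ∫ s in (-1 / 2 : ℝ)..(1 / 2), ∑' k : ℤ, f (s + k) := by
  have hae : ∀ᵐ s ∂(volume.restrict (Ioc (-1 / 2 : ℝ) (1 / 2))), s ≠ 0 ∧ |s| < 1 / 2 := by
    have h0 : ∀ᵐ s : ℝ ∂(volume.restrict (Ioc (-1 / 2 : ℝ) (1 / 2))), s ≠ 0 :=
      ae_restrict_of_ae (Measure.ae_ne volume 0)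
    have h1 : ∀ᵐ s : ℝ ∂(volume.restrict (Ioc (-1 / 2 : ℝ) (1 / 2))), s ≠ 1 / 2 :=
      ae_restrict_of_ae (Measure.ae_ne volume _)
    filter_upwards [ae_restrict_mem measurableSet_Ioc, h0, h1] with s hs hs0 hs1
    exact ⟨hs0, abs_lt.2 ⟨by linarith [hs.1], lt_of_le_of_ne hs.2 hs1⟩⟩
  have hb' : IntegrableOn b (Ioc (-1 / 2) (1 / 2)) :=
    (intervalIntegrable_iff_integrableOn_Ioc_of_le (by norm_num)).1 hb
  have hfk : ∀ k : ℤ, IntegrableOn (fun s => f (s + k)) (Ioc (-1 / 2) (1 / 2)) := fun k => by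
    refine (hb'.const_mul (Real.exp (-|(k : ℝ)|))).mono'
      (hf.comp (measurable_add_const _)).aestronglyMeasurable ?_
    filter_upwards [hae] with s hs
    exact h s k hs.1 hs.2
  have hfk' : ∀ k : ℤ, IntervalIntegrable (fun s => f (s + k)) volume (-1 / 2) (1 / 2) := fun k =>
    (intervalIntegrable_iff_integrableOn_Ioc_of_le (by norm_num)).2 (hfk k)
  have hnorm : ∀ k : ℤ, ∫ s in Ioc (-1 / 2 : ℝ) (1 / 2), ‖f (s + k)‖ ≤
      Real.exp (-|(k : ℝ)|) * ∫ s in Ioc (-1 / 2 : ℝ) (1 / 2), b s := fun k => by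
    rw [← integral_const_mul]
    refine integral_mono_ae (hfk k).norm (hb'.const_mul _) ?_
    filter_upwards [hae] with s hs
    exact h s k hs.1 hs.2
  have hsn : Summable fun k : ℤ => ∫ s in Ioc (-1 / 2 : ℝ) (1 / 2), ‖f (s + k)‖ :=
    Summable.of_nonneg_of_le (fun k => integral_nonneg fun _ => norm_nonneg _) hnorm
      (summable_exp_neg_abs_int.mul_right _)
  have hends : ∀ k : ℤ, (1 / 2 : ℝ) + k = -1 / 2 + k + 1 := fun k => by ring
  have hint : Integrable f := by
    rw [← integrableOn_univ, ← iUnion_Ioc_add_intCast (-1 / 2 : ℝ)]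
    refine integrableOn_iUnion_of_summable_integral_norm (fun k => ?_) ?_
    · have := (hfk' k).comp_add_right (-(k : ℝ))
      simp only [neg_add_cancel_right, sub_neg_eq_add, hends] at this
      exact (intervalIntegrable_iff_integrableOn_Ioc_of_le (by linarith)).1 this
    · refine hsn.congr fun k => ?_
      rw [← intervalIntegral.integral_of_le (by norm_num),
        ← intervalIntegral.integral_of_le (by linarith),
        intervalIntegral.integral_comp_add_right (fun s => ‖f s‖), hends]
  refine ⟨hint, ?_⟩
  have h1 := hasSum_integral_of_summable_integral_norm hfk hsn
  have h2 := hint.hasSum_intervalIntegral (-1 / 2)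
  rw [intervalIntegral.integral_of_le (by norm_num)]
  refine h2.unique (h1.congr_fun ?_)
  intro k
  rw [← intervalIntegral.integral_of_le (by norm_num),
    intervalIntegral.integral_comp_add_right f, hends]

lemma norm_tsum_periodization_le {f : ℝ → ℂ} {b : ℝ → ℝ} {s : ℝ}
    (h : ∀ k : ℤ, ‖f (s + k)‖ ≤ Real.exp (-|(k : ℝ)|) * b s) :
    ‖∑' k : ℤ, f (s + k)‖ ≤ (∑' k : ℤ, Real.exp (-|(k : ℝ)|)) * b s :=
  tsum_of_norm_bounded (summable_exp_neg_abs_int.hasSum.mul_right _) h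

lemma continuous_layer (κ : ℝ) : Continuous (layer κ) := by unfold layer; fun_prop

/-- The layer is at most the sum of two one-sided exponentials, one per endpoint, each of integral
at most `2/κ`. -/
lemma integral_layer_le {κ : ℝ} (hκ : 0 < κ) :
    ∫ s in (-1 / 2 : ℝ)..(1 / 2), layer κ s ≤ 4 / κ := by
  set g : ℝ → ℝ := fun s => Real.exp (-(κ * (1 / 2 - s) / 2)) + Real.exp (-(κ * (1 / 2 + s) / 2))
    with hg
  have hgc : Continuous g := by fun_prop
  have h1 : ∫ s in (-1 / 2 : ℝ)..(1 / 2), layer κ s ≤ ∫ s in (-1 / 2 : ℝ)..(1 / 2), g s := by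
    refine intervalIntegral.integral_mono_on (by norm_num)
      ((continuous_layer κ).intervalIntegrable _ _) (hgc.intervalIntegrable _ _) fun s _ => ?_
    unfold layer
    rcases abs_cases s with ⟨h, _⟩ | ⟨h, _⟩ <;> rw [h]
    · exact le_add_of_nonneg_right (Real.exp_pos _).le
    · rw [sub_neg_eq_add]; exact le_add_of_nonneg_left (Real.exp_pos _).le
  have h2 : ∀ s ∈ uIcc (-1 / 2 : ℝ) (1 / 2), HasDerivAt (fun s =>
      2 / κ * (Real.exp (-(κ * (1 / 2 - s) / 2)) - Real.exp (-(κ * (1 / 2 + s) / 2)))) (g s) s := by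
    intro s _
    have e1 : HasDerivAt (fun s : ℝ => -(κ * (1 / 2 - s) / 2)) (κ / 2) s :=
      (((((hasDerivAt_id s).const_sub (1 / 2)).const_mul κ).div_const 2).neg).congr_deriv (by ring)
    have e2 : HasDerivAt (fun s : ℝ => -(κ * (1 / 2 + s) / 2)) (-κ / 2) s :=
      (((((hasDerivAt_id s).const_add (1 / 2)).const_mul κ).div_const 2).neg).congr_deriv (by ring)
    refine ((e1.exp.sub e2.exp).const_mul (2 / κ)).congr_deriv ?_
    simp only [hg]
    field_simp
    ring
  rw [intervalIntegral.integral_eq_sub_of_hasDerivAt h2 (hgc.intervalIntegrable _ _)] at h1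
  refine h1.trans ?_
  norm_num
  have : 0 < Real.exp (-(κ / 2)) := Real.exp_pos _
  have h3 : 0 < 2 / κ := by positivity
  have h4 : 4 / κ = 2 / κ * 2 := by ring
  rw [h4]
  nlinarith

end Multiquadric

namespace Multiquadric

open Set Filter Topology

/-! ### Decay of the inverse Fourier transform -/

/-- The character `s ↦ e^{2 π i y s}`. -/
noncomputable def wave (y s : ℝ) : ℂ := Complex.exp ((y * (2 * Real.pi * s) : ℝ) * Complex.I)

lemma norm_wave (y s : ℝ) : ‖wave y s‖ = 1 := Complex.norm_exp_ofReal_mul_I _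

lemma continuous_wave_right (y : ℝ) : Continuous (wave y) := by unfold wave; fun_prop

lemma continuous_wave_left (s : ℝ) : Continuous fun y => wave y s := by unfold wave; fun_prop

/-- Since `e^{2πijk} = 1`, the values of the transform at `x + j` are Fourier coefficients of one
function of period-cell variable `s`. -/
lemma wave_add_int (x s : ℝ) (j k : ℤ) : wave (x + j) (s + k) = wave j s * wave x (s + k) := by
  unfold wave
  rw [← Complex.exp_add]
  refine Complex.exp_eq_exp_iff_exists_int.2 ⟨j * k, ?_⟩
  push_cast
  ring

lemma hasDerivAt_wave (y s : ℝ) :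
    HasDerivAt (wave y) (2 * Real.pi * y * Complex.I * wave y s) s := by
  have h1 : HasDerivAt (fun s : ℝ => y * (2 * Real.pi * s)) (y * (2 * Real.pi)) s := by
    simpa using ((hasDerivAt_id s).const_mul (2 * Real.pi)).const_mul y
  refine ((h1.ofReal_comp.mul_const Complex.I).cexp).congr_deriv ?_
  unfold wave
  push_cast
  ring

lemma fourier_eq_wave (j : ℤ) (s : ℝ) :
    fourier j (s : AddCircle (1 / 2 - -1 / 2 : ℝ)) = wave j s := by
  rw [fourier_coe_apply, wave]
  congr 1
  push_cast
  norm_num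
  ring

/-- The inverse Fourier transform of a real function, in the normalization of period `1`. -/
noncomputable def invFourier (φ : ℝ → ℝ) (y : ℝ) : ℂ := ∫ s, (φ s : ℂ) * wave y s

/-- Exponential localization of `φ`, with boundary layers of width `1 / κ` at `± 1/2`. -/
structure IsLocalized (φ : ℝ → ℝ) (M κ : ℝ) : Prop where
  continuous : Continuous φ
  pos : 0 < M
  bound : ∀ (s : ℝ) (k : ℤ), s ≠ 0 → |s| ≤ 1 / 2 → |φ (s + k)| ≤ M * Real.exp (-|(k : ℝ)|)
  differentiableAt : ∀ (s : ℝ) (k : ℤ), s ≠ 0 → |s| < 1 / 2 → DifferentiableAt ℝ φ (s + k)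
  deriv_bound : ∀ (s : ℝ) (k : ℤ), s ≠ 0 → |s| < 1 / 2 →
    |deriv φ (s + k)| ≤ M * κ * Real.exp (-|(k : ℝ)|) * layer κ s

lemma tsum_exp_pos : 0 < ∑' k : ℤ, Real.exp (-|(k : ℝ)|) :=
  summable_exp_neg_abs_int.tsum_pos (fun _ => (Real.exp_pos _).le) 0 (Real.exp_pos _)

lemma norm_integral_periodization_le {f : ℝ → ℂ} {b : ℝ → ℝ} (hf : Measurable f)
    (hb : IntervalIntegrable b volume (-1 / 2) (1 / 2))
    (h : ∀ (s : ℝ) (k : ℤ), s ≠ 0 → |s| < 1 / 2 → ‖f (s + k)‖ ≤ Real.exp (-|(k : ℝ)|) * b s) :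
    ‖∫ s, f s‖ ≤ (∑' k : ℤ, Real.exp (-|(k : ℝ)|)) * ∫ s in (-1 / 2 : ℝ)..(1 / 2), b s := by
  rw [(hasSum_integral_periodization hf hb h).2, ← intervalIntegral.integral_const_mul]
  refine intervalIntegral.norm_integral_le_of_norm_le (by norm_num) ?_ (hb.const_mul _)
  filter_upwards [Measure.ae_ne volume 0, Measure.ae_ne volume (1 / 2)] with s h0 h1 hs
  exact norm_tsum_periodization_le fun k =>
    h s k h0 (abs_lt.2 ⟨by linarith [hs.1], lt_of_le_of_ne hs.2 h1⟩)

namespace IsLocalized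

variable {φ : ℝ → ℝ} {M κ : ℝ}

lemma norm_mul_wave_le (h : IsLocalized φ M κ) (y : ℝ) {s : ℝ} (k : ℤ) (hs0 : s ≠ 0)
    (hs : |s| ≤ 1 / 2) : ‖(φ (s + k) : ℂ) * wave y (s + k)‖ ≤ Real.exp (-|(k : ℝ)|) * M := by
  rw [norm_mul, norm_wave, mul_one, Complex.norm_real, Real.norm_eq_abs, mul_comm]
  exact h.bound s k hs0 hs

lemma norm_deriv_mul_wave_le (h : IsLocalized φ M κ) (y : ℝ) {s : ℝ} (k : ℤ) (hs0 : s ≠ 0)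
    (hs : |s| < 1 / 2) : ‖((deriv φ (s + k) : ℝ) : ℂ) * wave y (s + k)‖ ≤
      Real.exp (-|(k : ℝ)|) * (M * κ * layer κ s) := by
  rw [norm_mul, norm_wave, mul_one, Complex.norm_real, Real.norm_eq_abs]
  exact (h.deriv_bound s k hs0 hs).trans_eq (by ring)

lemma measurable_mul_wave (h : IsLocalized φ M κ) (y : ℝ) :
    Measurable fun s => (φ s : ℂ) * wave y s :=
  ((Complex.continuous_ofReal.comp h.continuous).mul (continuous_wave_right y)).measurable

lemma measurable_deriv_mul_wave (y : ℝ) : Measurable fun s => ((deriv φ s : ℝ) : ℂ) * wave y s :=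
  (Complex.measurable_ofReal.comp (measurable_deriv φ)).mul (continuous_wave_right y).measurable

lemma intervalIntegrable_layer (C κ : ℝ) :
    IntervalIntegrable (fun s => C * layer κ s) volume (-1 / 2) (1 / 2) :=
  (continuous_const.mul (continuous_layer κ)).intervalIntegrable _ _

lemma integrable_mul_wave (h : IsLocalized φ M κ) (y : ℝ) :
    Integrable fun s => (φ s : ℂ) * wave y s :=
  (hasSum_integral_periodization (h.measurable_mul_wave y)
    (b := fun _ => M) intervalIntegrable_const
    fun _ k h0 hs => h.norm_mul_wave_le y k h0 hs.le).1

lemma integrable_deriv_mul_wave (h : IsLocalized φ M κ) (y : ℝ) :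
    Integrable fun s => ((deriv φ s : ℝ) : ℂ) * wave y s :=
  (hasSum_integral_periodization (measurable_deriv_mul_wave y) (intervalIntegrable_layer _ _)
    fun _ k h0 hs => h.norm_deriv_mul_wave_le y k h0 hs).1

lemma integrable (h : IsLocalized φ M κ) : Integrable φ := by
  have := (h.integrable_mul_wave 0).re
  simpa [wave] using this

lemma continuous_invFourier (h : IsLocalized φ M κ) : Continuous (invFourier φ) := by
  refine continuous_of_dominated (bound := fun s => ‖φ s‖)
    (fun y => (h.measurable_mul_wave y).aestronglyMeasurable) (fun y => ?_) h.integrable.norm ?_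
  · filter_upwards with s
    rw [norm_mul, norm_wave, mul_one, Complex.norm_real]
  · filter_upwards with s
    exact continuous_const.mul (continuous_wave_left s)

/-- Integration by parts. Differentiability may fail on the countable set `ℤ/2`, but continuity of
`φ` rules out jump terms, and boundary terms at `±(n + 1/2)` decay like `e^{-n}`. -/
lemma integral_deriv_mul_wave (h : IsLocalized φ M κ) (y : ℝ) :
    ∫ s, ((deriv φ s : ℝ) : ℂ) * wave y s = -(2 * Real.pi * y * Complex.I) * invFourier φ y := by
  set u : ℝ → ℂ := fun s => (φ s : ℂ) * wave y s with hu
  set u' : ℝ → ℂ := fun s => ((deriv φ s : ℝ) : ℂ) * wave y s +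
    2 * Real.pi * y * Complex.I * ((φ s : ℂ) * wave y s) with hu'
  have hcont : Continuous u := (Complex.continuous_ofReal.comp h.continuous).mul
    (continuous_wave_right y)
  have hint : Integrable u' :=
    (h.integrable_deriv_mul_wave y).add ((h.integrable_mul_wave y).const_mul _)
  have hderiv : ∀ s : ℝ, s ∉ range (fun k : ℤ => (k : ℝ) / 2) → HasDerivAt u (u' s) s := by
    intro s hs
    have h0 : s - round s ≠ 0 := fun h0 => hs ⟨2 * round s, by push_cast; linarith⟩
    have h1 : |s - round s| < 1 / 2 := by
      refine lt_of_le_of_ne (abs_sub_round s) fun h1 => ?_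
      rcases (abs_eq (by norm_num)).1 h1 with h1 | h1
      · exact hs ⟨2 * round s + 1, by push_cast; linarith⟩
      · exact hs ⟨2 * round s - 1, by push_cast; linarith⟩
    have hd := h.differentiableAt _ (round s) h0 h1
    rw [sub_add_cancel] at hd
    refine (hd.hasDerivAt.ofReal_comp.mul (hasDerivAt_wave y s)).congr_deriv ?_
    simp only [hu']
    ring
  have hFTC : ∀ n : ℕ, ∫ s in (-(n : ℝ) - 1 / 2)..((n : ℝ) + 1 / 2), u' s =
      u ((n : ℝ) + 1 / 2) - u (-(n : ℝ) - 1 / 2) := fun n =>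
    integral_eq_of_hasDerivAt_off_countable u u' (countable_range _) hcont.continuousOn
      (fun s hs => hderiv s hs.2) hint.intervalIntegrable
  have hlim1 : Tendsto (fun n : ℕ => ∫ s in (-(n : ℝ) - 1 / 2)..((n : ℝ) + 1 / 2), u' s) atTop
      (𝓝 (∫ s, u' s)) := by
    refine intervalIntegral_tendsto_integral hint ?_ ?_
    · exact tendsto_atBot_add_const_right _ _
        (tendsto_neg_atTop_atBot.comp tendsto_natCast_atTop_atTop)
    · exact tendsto_atTop_add_const_right _ _ tendsto_natCast_atTop_atTop
  have hlim2 : Tendsto (fun n : ℕ => u ((n : ℝ) + 1 / 2) - u (-(n : ℝ) - 1 / 2)) atTop (𝓝 0) := by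
    have hexp : Tendsto (fun n : ℕ => Real.exp (-(n : ℝ)) * M + Real.exp (-(n : ℝ)) * M) atTop
        (𝓝 0) := by
      have : Tendsto (fun n : ℕ => Real.exp (-(n : ℝ))) atTop (𝓝 0) :=
        Real.tendsto_exp_neg_atTop_nhds_zero.comp tendsto_natCast_atTop_atTop
      simpa using (this.mul_const M).add (this.mul_const M)
    refine squeeze_zero_norm (fun n => (norm_sub_le _ _).trans (add_le_add ?_ ?_)) hexp
    · have := h.norm_mul_wave_le y (s := 1 / 2) (n : ℤ) (by norm_num) (by norm_num [abs_of_pos])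
      simpa [hu, add_comm] using this
    · have := h.norm_mul_wave_le y (s := -1 / 2) (-n : ℤ) (by norm_num)
        (by rw [abs_le]; norm_num)
      have e : -(n : ℝ) - 1 / 2 = -1 / 2 + ((-(n : ℤ) : ℤ) : ℝ) := by push_cast; ring
      simp only [hu, e]
      simpa using this
  have h0 : ∫ s, u' s = 0 := by
    refine tendsto_nhds_unique hlim1 ?_
    simp only [hFTC]
    exact hlim2
  simp only [hu'] at h0
  rw [integral_add (h.integrable_deriv_mul_wave y) ((h.integrable_mul_wave y).const_mul _),
    integral_const_mul] at h0
  rw [invFourier]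
  linear_combination h0

lemma norm_invFourier_le (h : IsLocalized φ M κ) (y : ℝ) :
    ‖invFourier φ y‖ ≤ (∑' k : ℤ, Real.exp (-|(k : ℝ)|)) * M := by
  refine (norm_integral_periodization_le (h.measurable_mul_wave y) (b := fun _ => M)
    intervalIntegrable_const fun s k h0 hs => h.norm_mul_wave_le y k h0 hs.le).trans_eq ?_
  rw [intervalIntegral.integral_const]
  norm_num

lemma norm_two_pi_mul_invFourier (φ : ℝ → ℝ) (y : ℝ) :
    ‖-(2 * Real.pi * y * Complex.I) * invFourier φ y‖ = 2 * Real.pi * |y| * ‖invFourier φ y‖ := by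
  rw [norm_mul, norm_neg, norm_mul, norm_mul, norm_mul, Complex.norm_I, Complex.norm_real,
    Complex.norm_real, Real.norm_of_nonneg Real.pi_pos.le, Real.norm_eq_abs]
  simp

lemma abs_le_two_pi_mul (y : ℝ) : |y| ≤ 2 * Real.pi * |y| := by
  nlinarith [Real.pi_gt_three, abs_nonneg y]

/-- The height `κ` of the derivative cancels against the width `1/κ` of the layer. -/
lemma abs_mul_norm_invFourier_le (h : IsLocalized φ M κ) (hκ : 0 < κ) (y : ℝ) :
    |y| * ‖invFourier φ y‖ ≤ (∑' k : ℤ, Real.exp (-|(k : ℝ)|)) * (4 * M) := by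
  have h1 := norm_integral_periodization_le (measurable_deriv_mul_wave y)
    (intervalIntegrable_layer _ _) fun s k h0 hs => h.norm_deriv_mul_wave_le y k h0 hs
  rw [h.integral_deriv_mul_wave, norm_two_pi_mul_invFourier,
    intervalIntegral.integral_const_mul] at h1
  have hM := h.pos
  calc |y| * ‖invFourier φ y‖ ≤ 2 * Real.pi * |y| * ‖invFourier φ y‖ := by
        gcongr; exact abs_le_two_pi_mul y
    _ ≤ _ := h1
    _ ≤ (∑' k : ℤ, Real.exp (-|(k : ℝ)|)) * (M * κ * (4 / κ)) := by
        gcongr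
        exact integral_layer_le hκ
    _ = _ := by field_simp

lemma sq_sum_invFourier_le (h : IsLocalized φ M κ) (hκ : 0 < κ) (x : ℝ) :
    Summable (fun j : ℤ => (x + j) ^ 2 * ‖invFourier φ (x + j)‖ ^ 2) ∧
      ∑' j : ℤ, (x + j) ^ 2 * ‖invFourier φ (x + j)‖ ^ 2 ≤
        2 * ((∑' k : ℤ, Real.exp (-|(k : ℝ)|)) * M) ^ 2 * κ := by
  set S : ℝ := ∑' k : ℤ, Real.exp (-|(k : ℝ)|) with hS
  have hS0 : 0 < S := tsum_exp_pos
  have hM := h.pos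
  have hab : (-1 / 2 : ℝ) < 1 / 2 := by norm_num
  set q : ℝ → ℂ := fun s => ∑' k : ℤ, ((deriv φ (s + k) : ℝ) : ℂ) * wave x (s + k) with hq
  have hqm : Measurable q := Measurable.tsum fun k =>
    (measurable_deriv_mul_wave (φ := φ) x).comp (measurable_add_const _)
  have hqle : ∀ᵐ s ∂(volume.restrict (Ioc (-1 / 2 : ℝ) (1 / 2))),
      ‖q s‖ ≤ S * (M * κ * layer κ s) := by
    filter_upwards [ae_restrict_mem measurableSet_Ioc,
      ae_restrict_of_ae (Measure.ae_ne volume 0),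
      ae_restrict_of_ae (Measure.ae_ne volume (1 / 2))] with s hs h0 h1
    exact norm_tsum_periodization_le (f := fun s => ((deriv φ s : ℝ) : ℂ) * wave x s)
      (b := fun s => M * κ * layer κ s) fun k => h.norm_deriv_mul_wave_le x k h0
      (abs_lt.2 ⟨by linarith [hs.1], lt_of_le_of_ne hs.2 h1⟩)
  have hqL2 : MemLp q 2 (volume.restrict (Ioc (-1 / 2 : ℝ) (1 / 2))) := by
    refine MemLp.of_bound hqm.aestronglyMeasurable (S * (M * κ * 1)) ?_
    filter_upwards [hqle, ae_restrict_mem measurableSet_Ioc] with s hs hs'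
    refine hs.trans ?_
    gcongr
    exact layer_le_one hκ.le (abs_le.2 ⟨by linarith [hs'.1], hs'.2⟩)
  -- The index is `-j` because Fourier coefficients use the conjugate of the character in
  -- `invFourier`.
  have hcoef : ∀ j : ℤ, fourierCoeffOn hab q (-j) =
      -(2 * Real.pi * (x + j : ℝ) * Complex.I) * invFourier φ (x + j) := by
    intro j
    rw [fourierCoeffOn_eq_integral, ← h.integral_deriv_mul_wave,
      (hasSum_integral_periodization (measurable_deriv_mul_wave _) (intervalIntegrable_layer _ _)
        fun s k h0 hs => h.norm_deriv_mul_wave_le (x + j) k h0 hs).2, neg_neg]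
    have : (1 / (1 / 2 - -1 / 2) : ℝ) = 1 := by norm_num
    rw [this, one_smul]
    refine intervalIntegral.integral_congr fun s _ => ?_
    simp only [hq]
    rw [fourier_eq_wave, smul_eq_mul, ← tsum_mul_left]
    refine tsum_congr fun k => ?_
    rw [wave_add_int]
    ring
  have hpars := (hasSum_sq_fourierCoeffOn hab hqL2)
  have hpars' := (Equiv.neg ℤ).hasSum_iff.2 hpars
  have e : ((fun i : ℤ => ‖fourierCoeffOn hab q i‖ ^ 2) ∘ Equiv.neg ℤ) =
      fun j : ℤ => (2 * Real.pi * |x + j| * ‖invFourier φ (x + j)‖) ^ 2 := by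
    ext j
    simp only [Function.comp, Equiv.neg_apply]
    rw [hcoef, norm_two_pi_mul_invFourier]
  rw [e] at hpars'
  have hle : ∀ j : ℤ, (x + j) ^ 2 * ‖invFourier φ (x + j)‖ ^ 2 ≤
      (2 * Real.pi * |x + j| * ‖invFourier φ (x + j)‖) ^ 2 := fun j => by
    rw [← sq_abs (x + j), ← mul_pow]
    gcongr
    exact abs_le_two_pi_mul _
  have hsum := Summable.of_nonneg_of_le (fun j => by positivity) hle hpars'.summable
  refine ⟨hsum, (hsum.tsum_le_tsum hle hpars'.summable).trans ?_⟩
  rw [hpars'.tsum_eq]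
  have : ((1 / 2 - -1 / 2 : ℝ))⁻¹ = 1 := by norm_num
  rw [this, one_smul]
  -- Squaring the layer doubles `κ`, so the integral is `O(κ² · 1/κ) = O(κ)`.
  have hsq : ∀ s, (S * (M * κ * layer κ s)) ^ 2 = (S * M * κ) ^ 2 * layer (2 * κ) s := by
    intro s
    have : layer κ s ^ 2 = layer (2 * κ) s := by
      unfold layer
      rw [← Real.exp_nat_mul]
      congr 1
      push_cast
      ring
    rw [← this]
    ring
  calc ∫ s in (-1 / 2 : ℝ)..(1 / 2), ‖q s‖ ^ 2
      ≤ ∫ s in (-1 / 2 : ℝ)..(1 / 2), (S * M * κ) ^ 2 * layer (2 * κ) s := by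
        rw [intervalIntegral.integral_of_le hab.le, intervalIntegral.integral_of_le hab.le]
        refine integral_mono_ae (hqL2.integrable_norm_pow (by norm_num))
          ((intervalIntegrable_iff_integrableOn_Ioc_of_le hab.le).1
            (intervalIntegrable_layer _ _)) ?_
        filter_upwards [hqle] with s hs
        rw [← hsq]
        gcongr
    _ ≤ (S * M * κ) ^ 2 * (4 / (2 * κ)) := by
        rw [intervalIntegral.integral_const_mul]
        gcongr
        exact integral_layer_le (by positivity)
    _ = _ := by field_simp; ring

lemma lebesgue_bound {M : ℝ} (hM : 0 < M) : ∃ A : ℝ, 0 < A ∧ ∀ (φ : ℝ → ℝ) (κ : ℝ), 1 ≤ κ →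
    IsLocalized φ M κ → ∀ x : ℝ, Summable (fun j : ℤ => ‖invFourier φ (x + j)‖) ∧
      ∑' j : ℤ, ‖invFourier φ (x + j)‖ ≤ A * (1 + Real.log κ) := by
  set S : ℝ := ∑' k : ℤ, Real.exp (-|(k : ℝ)|) with hS
  have hS0 : 0 < S := tsum_exp_pos
  have hSM : 0 < S * M := by positivity
  -- The inner sum is a common `B` for the constants `SM`, `4SM` and `2(SM)²` of the three kernel
  -- bounds.
  refine ⟨4 + 5 * (4 * (S * M) + 2 * (S * M) ^ 2), by positivity, fun φ κ hκ h x => ?_⟩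
  have hκ0 : 0 < κ := by linarith
  refine summable_and_tsum_le (w := fun y => ‖invFourier φ y‖) hκ (fun y => norm_nonneg _)
    (fun y => (h.norm_invFourier_le y).trans ?_)
    (fun y => (h.abs_mul_norm_invFourier_le hκ0 y).trans ?_) (fun x => ?_) x
  · nlinarith [sq_nonneg (S * M)]
  · nlinarith [sq_nonneg (S * M)]
  · obtain ⟨h1, h2⟩ := h.sq_sum_invFourier_le hκ0 x
    refine ⟨h1, h2.trans ?_⟩
    gcongr
    linarith

end IsLocalized

end Multiquadric

namespace Multiquadric

open Set Filter Topology

/-! ### The interpolation operators -/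

/-- `∑_j y_j L(x - j)` for a kernel `L`. -/
noncomputable def shiftSum (L : ℝ → ℂ) (y : ℤ → ℂ) (x : ℝ) : ℂ := ∑' j : ℤ, y j * L (x - j)

lemma exists_operator {p : ENNReal} [Fact (1 ≤ p)] {B : ℝ} (hB : 0 ≤ B) (K : (ℤ → ℂ) → ℝ → ℂ)
    (hadd : ∀ y z : lp (fun _ : ℤ => ℂ) p, K (⇑y + ⇑z) = K y + K z)
    (hsmul : ∀ (a : ℂ) (y : lp (fun _ : ℤ => ℂ) p), K (a • ⇑y) = a • K y)
    (hmeas : ∀ y : lp (fun _ : ℤ => ℂ) p, Measurable (K y))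
    (hle : ∀ y : lp (fun _ : ℤ => ℂ) p, eLpNorm (K y) p volume ≤ ENNReal.ofReal (B * ‖y‖)) :
    ∃ T : lp (fun _ : ℤ => ℂ) p →L[ℂ] Lp ℂ p (volume : Measure ℝ),
      (∀ y : lp (fun _ : ℤ => ℂ) p, T y =ᵐ[volume] K y) ∧ ‖T‖ ≤ B := by
  have hmem : ∀ y : lp (fun _ : ℤ => ℂ) p, MemLp (K y) p volume := fun y =>
    ⟨(hmeas y).aestronglyMeasurable, (hle y).trans_lt ENNReal.ofReal_lt_top⟩
  set T₀ : lp (fun _ : ℤ => ℂ) p →ₗ[ℂ] Lp ℂ p (volume : Measure ℝ) :=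
    { toFun := fun y => (hmem y).toLp
      map_add' := fun y z => by
        rw [← MemLp.toLp_add]
        exact MemLp.toLp_congr _ _ (by rw [← hadd]; rfl)
      map_smul' := fun a y => by
        rw [RingHom.id_apply, ← MemLp.toLp_const_smul]
        exact MemLp.toLp_congr _ _ (by rw [← hsmul]; rfl) } with hT₀
  have hbound : ∀ y, ‖T₀ y‖ ≤ B * ‖y‖ := fun y => by
    change ‖(hmem y).toLp‖ ≤ _
    rw [Lp.norm_toLp]
    exact ENNReal.toReal_le_of_le_ofReal (by positivity) (hle y)
  exact ⟨T₀.mkContinuous B hbound, fun y => (hmem y).coeFn_toLp,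
    T₀.mkContinuous_norm_le hB hbound⟩

/-! ### Operator bounds from a bounded Lebesgue function -/

section Kernel

variable {L : ℝ → ℂ} {B : ℝ}

lemma summable_and_tsum_sub_le
    (h : ∀ x : ℝ, Summable (fun j : ℤ => ‖L (x + j)‖) ∧ ∑' j : ℤ, ‖L (x + j)‖ ≤ B) (x : ℝ) :
    Summable (fun j : ℤ => ‖L (x - j)‖) ∧ ∑' j : ℤ, ‖L (x - j)‖ ≤ B := by
  have e : (fun j : ℤ => ‖L (x - j)‖) = (fun j : ℤ => ‖L (x + j)‖) ∘ Equiv.neg ℤ := by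
    ext j; simp [sub_eq_add_neg]
  rw [e]
  exact ⟨(Equiv.summable_iff _).2 (h x).1,
    (Equiv.tsum_eq (Equiv.neg ℤ) (fun j : ℤ => ‖L (x + j)‖)).trans_le (h x).2⟩

lemma norm_mul_le_lp {p : ENNReal} [Fact (1 ≤ p)] (y : lp (fun _ : ℤ => ℂ) p) (x : ℝ) (j : ℤ) :
    ‖y j * L (x - j)‖ ≤ ‖y‖ * ‖L (x - j)‖ := by
  rw [norm_mul]
  gcongr
  exact lp.norm_apply_le_norm (zero_lt_one.trans_le (Fact.out : 1 ≤ p)).ne' y j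

lemma summable_shiftSum {p : ENNReal} [Fact (1 ≤ p)]
    (h : ∀ x : ℝ, Summable (fun j : ℤ => ‖L (x + j)‖) ∧ ∑' j : ℤ, ‖L (x + j)‖ ≤ B)
    (y : lp (fun _ : ℤ => ℂ) p) (x : ℝ) : Summable fun j : ℤ => y j * L (x - j) :=
  Summable.of_norm_bounded ((summable_and_tsum_sub_le h x).1.mul_left ‖y‖)
    (norm_mul_le_lp y x)

lemma norm_shiftSum_le {p : ENNReal} [Fact (1 ≤ p)]
    (h : ∀ x : ℝ, Summable (fun j : ℤ => ‖L (x + j)‖) ∧ ∑' j : ℤ, ‖L (x + j)‖ ≤ B)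
    (y : lp (fun _ : ℤ => ℂ) p) (x : ℝ) : ‖shiftSum L y x‖ ≤ B * ‖y‖ := by
  obtain ⟨h1, h2⟩ := summable_and_tsum_sub_le h x
  refine (tsum_of_norm_bounded (h1.hasSum.mul_left ‖y‖) (norm_mul_le_lp y x)).trans ?_
  rw [mul_comm]
  gcongr

lemma measurable_shiftSum (hL : Continuous L) (y : ℤ → ℂ) : Measurable (shiftSum L y) :=
  Measurable.tsum fun j => (hL.measurable.comp (measurable_id.sub_const (j : ℝ))).const_mul (y j)

lemma shiftSum_add {p : ENNReal} [Fact (1 ≤ p)]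
    (h : ∀ x : ℝ, Summable (fun j : ℤ => ‖L (x + j)‖) ∧ ∑' j : ℤ, ‖L (x + j)‖ ≤ B)
    (y z : lp (fun _ : ℤ => ℂ) p) :
    shiftSum L (⇑y + ⇑z) = shiftSum L y + shiftSum L z := by
  ext x
  simp only [shiftSum, Pi.add_apply, add_mul]
  exact (summable_shiftSum h y x).tsum_add (summable_shiftSum h z x)

lemma shiftSum_smul (a : ℂ) (y : ℤ → ℂ) : shiftSum L (a • y) = a • shiftSum L y := by
  ext x
  simp only [shiftSum, Pi.smul_apply, smul_eq_mul, mul_assoc]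
  exact tsum_mul_left

/-- By Tonelli, `‖L‖_1` is the integral of the Lebesgue function over one period. -/
lemma lintegral_enorm_le (hL : Continuous L)
    (h : ∀ x : ℝ, Summable (fun j : ℤ => ‖L (x + j)‖) ∧ ∑' j : ℤ, ‖L (x + j)‖ ≤ B) :
    ∫⁻ x, ‖L x‖ₑ ≤ ENNReal.ofReal B := by
  have hshift : ∀ k : ℤ, ∫⁻ x in Ioc (k : ℝ) (k + 1), ‖L x‖ₑ =
      ∫⁻ x in Ioc (0 : ℝ) 1, ‖L (x + k)‖ₑ := fun k => by
    have := (measurePreserving_add_right volume (k : ℝ)).setLIntegral_comp_preimage_emb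
      (measurableEmbedding_addRight (k : ℝ)) (fun x => ‖L x‖ₑ) (Ioc (k : ℝ) (k + 1))
    rw [← this]
    simp
  have hpt : ∀ x : ℝ, ∑' k : ℤ, ‖L (x + k)‖ₑ ≤ ENNReal.ofReal B := fun x => by
    simp_rw [← ofReal_norm]
    rw [← ENNReal.ofReal_tsum_of_nonneg (fun _ => norm_nonneg _) (h x).1]
    exact ENNReal.ofReal_le_ofReal (h x).2
  calc ∫⁻ x, ‖L x‖ₑ = ∫⁻ x in ⋃ k : ℤ, Ioc (k : ℝ) (k + 1), ‖L x‖ₑ := by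
        rw [iUnion_Ioc_intCast, Measure.restrict_univ]
    _ = ∑' k : ℤ, ∫⁻ x in Ioc (0 : ℝ) 1, ‖L (x + k)‖ₑ := by
        rw [lintegral_iUnion (fun _ => measurableSet_Ioc) (pairwise_disjoint_Ioc_intCast ℝ)]
        exact tsum_congr hshift
    _ = ∫⁻ x in Ioc (0 : ℝ) 1, ∑' k : ℤ, ‖L (x + k)‖ₑ :=
        (lintegral_tsum fun k : ℤ =>
          (hL.measurable.comp (measurable_add_const (k : ℝ))).enorm.aemeasurable).symm
    _ ≤ ∫⁻ _ in Ioc (0 : ℝ) 1, ENNReal.ofReal B := lintegral_mono hpt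
    _ = ENNReal.ofReal B := by simp

lemma lp_one_tsum_enorm (y : lp (fun _ : ℤ => ℂ) (1 : ENNReal)) :
    ∑' j : ℤ, ‖y j‖ₑ = ENNReal.ofReal ‖y‖ := by
  have h1 : Summable fun j : ℤ => ‖y j‖ := by
    simpa using (lp.memℓp y).summable (by norm_num)
  have h2 : ‖y‖ = ∑' j : ℤ, ‖y j‖ := by
    simpa using lp.norm_eq_tsum_rpow (by norm_num : 0 < (1 : ENNReal).toReal) y
  simp_rw [← ofReal_norm]
  rw [h2, ENNReal.ofReal_tsum_of_nonneg (fun _ => norm_nonneg _) h1]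

lemma eLpNorm_one_shiftSum_le (hL : Continuous L)
    (h : ∀ x : ℝ, Summable (fun j : ℤ => ‖L (x + j)‖) ∧ ∑' j : ℤ, ‖L (x + j)‖ ≤ B)
    (y : lp (fun _ : ℤ => ℂ) (1 : ENNReal)) :
    eLpNorm (shiftSum L y) 1 volume ≤ ENNReal.ofReal (B * ‖y‖) := by
  rw [eLpNorm_one_eq_lintegral_enorm]
  calc ∫⁻ x, ‖shiftSum L y x‖ₑ ≤ ∫⁻ x, ∑' j : ℤ, ‖y j‖ₑ * ‖L (x - j)‖ₑ := by
        refine lintegral_mono fun x => ?_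
        simp_rw [← enorm_mul]
        exact enorm_tsum_le_tsum_enorm
    _ = ∑' j : ℤ, ‖y j‖ₑ * ∫⁻ x, ‖L x‖ₑ := by
        have hm : ∀ j : ℤ, Measurable fun x : ℝ => ‖L (x - j)‖ₑ := fun j =>
          (hL.measurable.comp (measurable_sub_const (j : ℝ))).enorm
        rw [lintegral_tsum fun j => ((hm j).const_mul _).aemeasurable]
        refine tsum_congr fun j => ?_
        rw [lintegral_const_mul _ (hm j), lintegral_sub_right_eq_self (fun x => ‖L x‖ₑ)]
    _ = ENNReal.ofReal ‖y‖ * ∫⁻ x, ‖L x‖ₑ := by rw [ENNReal.tsum_mul_right, lp_one_tsum_enorm]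
    _ ≤ ENNReal.ofReal ‖y‖ * ENNReal.ofReal B := by gcongr; exact lintegral_enorm_le hL h
    _ = _ := by rw [← ENNReal.ofReal_mul (norm_nonneg _), mul_comm]

lemma eLpNorm_top_shiftSum_le
    (h : ∀ x : ℝ, Summable (fun j : ℤ => ‖L (x + j)‖) ∧ ∑' j : ℤ, ‖L (x + j)‖ ≤ B)
    (y : lp (fun _ : ℤ => ℂ) (⊤ : ENNReal)) :
    eLpNorm (shiftSum L y) ⊤ volume ≤ ENNReal.ofReal (B * ‖y‖) := by
  rw [eLpNorm_exponent_top]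
  exact eLpNormEssSup_le_of_ae_bound (Eventually.of_forall (norm_shiftSum_le h y))

end Kernel

/-! ### Identification of the fundamental function -/

/-- Substitute `x = 1 + u/r`, so that `r²(x² - 1) = u(u + 2r)`. -/
lemma integral_bessel_eq_profile (p : ℝ) {r : ℝ} (hr : 0 < r) :
    ∫ x in Ioi (1 : ℝ), Real.exp (-r * x) * (x ^ 2 - 1) ^ p =
      r ^ (-(2 * p + 1)) * profile p r := by
  rw [← setIntegral_Ioi_comp_add]
  set G : ℝ → ℝ := fun u => r ^ (-(2 * p)) * Real.exp (-r) *
    (Real.exp (-u) * (u * (u + 2 * r)) ^ p) with hG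
  have h1 : ∫ t in Ioi (0 : ℝ), Real.exp (-r * (t + 1)) * ((t + 1) ^ 2 - 1) ^ p =
      ∫ t in Ioi (0 : ℝ), G (r * t) := by
    refine setIntegral_congr_fun measurableSet_Ioi fun t ht => ?_
    have ht : 0 < t := ht
    simp only [hG]
    have e1 : r * t * (r * t + 2 * r) = r ^ 2 * ((t + 1) ^ 2 - 1) := by ring
    have e2 : (0 : ℝ) ≤ (t + 1) ^ 2 - 1 := by nlinarith
    have e3 : (r ^ 2) ^ p = r ^ (2 * p) := by rw [Real.rpow_mul hr.le, Real.rpow_two]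
    have e4 : Real.exp (-r * (t + 1)) = Real.exp (-r) * Real.exp (-(r * t)) := by
      rw [← Real.exp_add]; congr 1; ring
    rw [e1, Real.mul_rpow (by positivity) e2, e3, e4, Real.rpow_neg hr.le]
    field_simp
  rw [h1, integral_comp_mul_left_Ioi G 0 hr, mul_zero, smul_eq_mul, integral_const_mul, profile,
    polyPart]
  have e5 : r ^ (-(2 * p + 1)) = r⁻¹ * r ^ (-(2 * p)) := by
    rw [neg_add, Real.rpow_add hr, Real.rpow_neg_one, mul_comm]
  rw [e5]
  ring

lemma div_rpow_mul_mul_rpow_neg {c t : ℝ} (hc : 0 < c) (ht : 0 < t) (a ν : ℝ) :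
    (c / t) ^ a * (c * t) ^ (-ν) = c ^ (a - ν) * t ^ (-(a + ν)) := by
  rw [Real.div_rpow hc.le ht.le, Real.mul_rpow hc.le ht.le, neg_add, Real.rpow_add ht,
    Real.rpow_neg ht.le a, sub_eq_add_neg, Real.rpow_add hc]
  field_simp

/-- `K_ν(r)` is a constant times `r^{-ν} F(r)`, which with `(c/|ξ|)^a` leaves `|ξ|^{-(a+ν)}`. The
constant is nonzero because `-α` is not a pole of Gamma. -/
lemma exists_phiHat_eq {α c : ℝ} (hα : ∀ n : ℕ, α ≠ n) (hc : 0 < c) : ∃ Q : ℝ, Q ≠ 0 ∧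
    ∀ s : ℝ, s ≠ 0 → phiHat α c (2 * Real.pi * s) =
      Q * radial (α + 1 / 2 + |α + 1 / 2|) (|α + 1 / 2| - 1 / 2) (2 * Real.pi * c) s := by
  set a := α + 1 / 2 with ha
  set ν := |a| with hν
  have hν0 : 0 ≤ ν := abs_nonneg a
  have hΓ : Real.Gamma (-α) ≠ 0 := Real.Gamma_ne_zero fun m hm => hα m (by linarith)
  have hΓ1 : 0 < Real.Gamma (1 / 2) := Real.Gamma_pos_of_pos (by norm_num)
  have hΓ2 : 0 < Real.Gamma (ν + 1 / 2) := Real.Gamma_pos_of_pos (by positivity)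
  have hpi : 0 < 2 * Real.pi := by positivity
  refine ⟨2 ^ (1 + α) / Real.Gamma (-α) * (Real.Gamma (1 / 2) / (2 ^ ν * Real.Gamma (ν + 1 / 2))) *
    (c ^ (a - ν) * (2 * Real.pi) ^ (-(a + ν))), by positivity, fun s hs => ?_⟩
  have hs' : 0 < |s| := abs_pos.2 hs
  have habs : |2 * Real.pi * s| = 2 * Real.pi * |s| := by rw [abs_mul, abs_of_pos hpi]
  have hcs : 0 < c * (2 * Real.pi * |s|) := by positivity
  unfold phiHat besselK radial
  rw [← ha, ← hν, habs, integral_bessel_eq_profile _ hcs]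
  have e0 : 2 * Real.pi * c * |s| = c * (2 * Real.pi * |s|) := by ring
  rw [e0]
  have e1 : (c / (2 * Real.pi * |s|)) ^ a * ((c * (2 * Real.pi * |s|)) ^ ν *
      (c * (2 * Real.pi * |s|)) ^ (-(2 * (ν - 1 / 2) + 1))) =
      c ^ (a - ν) * (2 * Real.pi) ^ (-(a + ν)) * |s| ^ (-(a + ν)) := by
    have e2 : ν + -(2 * (ν - 1 / 2) + 1) = -ν := by ring
    rw [← Real.rpow_add hcs, e2, div_rpow_mul_mul_rpow_neg hc (by positivity),
      Real.mul_rpow hpi.le hs'.le, mul_assoc]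
  linear_combination (2 ^ (1 + α) / Real.Gamma (-α) *
    (Real.Gamma (1 / 2) / (2 ^ ν * Real.Gamma (ν + 1 / 2)))) *
    profile (ν - 1 / 2) (c * (2 * Real.pi * |s|)) * e1

section Identify

variable {α c : ℝ}

lemma fundamentalHat_ae_eq (hα : ∀ n : ℕ, α ≠ n) (hc : 0 < c) :
    (fun s => fundamentalHat α c (2 * Real.pi * s)) =ᵐ[volume]
      cardinalHat (α + 1 / 2 + |α + 1 / 2|) (|α + 1 / 2| - 1 / 2) (2 * Real.pi * c) := by
  obtain ⟨Q, hQ, h⟩ := exists_phiHat_eq hα hc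
  filter_upwards [(countable_range (fun k : ℤ => (k : ℝ))).ae_notMem volume] with s hs
  have hs' : ∀ k : ℤ, s ≠ k := fun k hk => hs ⟨k, hk.symm⟩
  have hsum : ∀ j : ℤ, phiHat α c (2 * Real.pi * s + 2 * Real.pi * j) =
      Q * radial (α + 1 / 2 + |α + 1 / 2|) (|α + 1 / 2| - 1 / 2) (2 * Real.pi * c) (s + j) :=
    fun j => by rw [← mul_add]; exact h _ (add_int_ne_zero hs' j)
  rw [cardinalHat_eq_radial hs', fundamentalHat, h s (by simpa using hs' 0), tsum_congr hsum,
    tsum_mul_left, mul_div_mul_left _ _ hQ]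

lemma fundamentalFn_eq_invFourier (hα : ∀ n : ℕ, α ≠ n) (hc : 0 < c) :
    fundamentalFn α c = invFourier
      (cardinalHat (α + 1 / 2 + |α + 1 / 2|) (|α + 1 / 2| - 1 / 2) (2 * Real.pi * c)) := by
  ext x
  have hpi : 0 < 2 * Real.pi := by positivity
  have h := Measure.integral_comp_mul_left
    (fun ξ : ℝ => (fundamentalHat α c ξ : ℂ) * Complex.exp (Complex.I * x * ξ)) (2 * Real.pi)
  rw [abs_of_pos (inv_pos.2 hpi), Complex.real_smul] at h
  have e : fundamentalFn α c x = ∫ s : ℝ, (fundamentalHat α c (2 * Real.pi * s) : ℂ) *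
      Complex.exp (Complex.I * x * ((2 * Real.pi * s : ℝ) : ℂ)) := by
    rw [h, fundamentalFn]
    push_cast
    rw [one_div]
  rw [e, invFourier]
  refine integral_congr_ae ?_
  filter_upwards [fundamentalHat_ae_eq hα hc] with s hs
  rw [hs, wave]
  congr 2
  push_cast
  ring

lemma integrable_fundamentalHat (hα : ∀ n : ℕ, α ≠ n) (hc : 0 < c)
    (h : Integrable
      (cardinalHat (α + 1 / 2 + |α + 1 / 2|) (|α + 1 / 2| - 1 / 2) (2 * Real.pi * c))) :
    Integrable (fundamentalHat α c) :=
  (integrable_comp_mul_left_iff _ (by positivity : 2 * Real.pi ≠ 0)).1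
    (h.congr (fundamentalHat_ae_eq hα hc).symm)

end Identify

/-! ### Assembly -/

lemma exists_isLocalized_cardinalHat {σ p : ℝ} (hσ : σ = 0 ∨ 1 ≤ σ) (hp : 0 < p) :
    ∃ M : ℝ, 0 < M ∧ ∀ κ : ℝ, 4 ≤ κ → IsLocalized (cardinalHat σ p κ) M κ := by
  obtain ⟨M₁, hM₁, h₁⟩ := exists_cardinalHat_le hσ hp
  obtain ⟨M₂, hM₂, h₂⟩ := exists_deriv_cardinalHat_le hσ hp
  have hσ0 : 0 ≤ σ := by rcases hσ with h | h <;> linarith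
  refine ⟨M₁ + M₂, by positivity, fun κ hκ => ⟨continuous_cardinalHat hσ0 hp hκ, by positivity,
    fun s k hs0 hs => (h₁ κ s k hκ hs0 hs).trans ?_, fun s k hs0 hs => (h₂ κ s k hκ hs0 hs).1,
    fun s k hs0 hs => (h₂ κ s k hκ hs0 hs).2.trans ?_⟩⟩
  · gcongr; linarith
  · have := layer_pos κ s
    gcongr
    linarith

end Multiquadric

theorem mainTheorem8 (α : ℝ)
    (hα : α ∈ Set.Iio (-3 / 2 : ℝ) ∪ (Set.Ici (1 / 2 : ℝ) \ Set.range (fun n : ℕ => (n : ℝ)))) :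
    ∃ A : ℝ, 0 < A ∧ ∀ c : ℝ, 1 ≤ c →
      Integrable (Multiquadric.fundamentalHat α c) volume ∧
      (∀ x : ℝ, Summable (fun j : ℤ => ‖Multiquadric.fundamentalFn α c (x + j)‖) ∧
        Multiquadric.lebesgueFn α c x ≤ A * (1 + Real.log c)) ∧
      (∃ T : lp (fun _ : ℤ => ℂ) (⊤ : ENNReal) →L[ℂ] Lp ℂ (⊤ : ENNReal) (volume : Measure ℝ),
        Multiquadric.IsInterpOperator α c ⊤ T ∧ ‖T‖ ≤ A * (1 + Real.log c)) ∧
      (∃ T : lp (fun _ : ℤ => ℂ) (1 : ENNReal) →L[ℂ] Lp ℂ (1 : ENNReal) (volume : Measure ℝ),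
        Multiquadric.IsInterpOperator α c 1 T ∧ ‖T‖ ≤ A * (1 + Real.log c)) := by
  open Multiquadric in
  have hαn : ∀ n : ℕ, α ≠ n := by
    rintro n rfl
    rcases hα with h | h
    · have h : (n : ℝ) < -3 / 2 := h
      linarith [(Nat.cast_nonneg n : (0 : ℝ) ≤ n)]
    · exact h.2 ⟨n, rfl⟩
  -- For `α < -3/2`, `σ = 0` and `p = -α - 1`; for `α ≥ 1/2`, `σ = 2α + 1` and `p = α`.
  have hσp : (α + 1 / 2 + |α + 1 / 2| = 0 ∨ 1 ≤ α + 1 / 2 + |α + 1 / 2|) ∧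
      0 < |α + 1 / 2| - 1 / 2 := by
    rcases hα with h | h
    · have h : α < -3 / 2 := h
      rw [abs_of_neg (by linarith)]
      exact ⟨Or.inl (by ring), by linarith⟩
    · have h : 1 / 2 ≤ α := h.1
      rw [abs_of_pos (by linarith)]
      exact ⟨Or.inr (by linarith), by linarith⟩
  obtain ⟨M, hM, hloc⟩ := exists_isLocalized_cardinalHat hσp.1 hσp.2
  obtain ⟨A, hA, hbound⟩ := IsLocalized.lebesgue_bound hM
  have hlog2 : 0 ≤ Real.log (2 * Real.pi) := Real.log_nonneg (by linarith [Real.pi_gt_three])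
  -- With `κ = 2πc`, `1 + log κ ≤ (1 + log 2π)(1 + log c)`.
  refine ⟨A * (1 + Real.log (2 * Real.pi)), by positivity, fun c hc => ?_⟩
  have hc0 : 0 < c := by linarith
  have hlogc := Real.log_nonneg hc
  have hκ : 4 ≤ 2 * Real.pi * c := by nlinarith [Real.pi_gt_three]
  have hl := hloc _ hκ
  have hB : ∀ x : ℝ, Summable (fun j : ℤ => ‖fundamentalFn α c (x + j)‖) ∧
      ∑' j : ℤ, ‖fundamentalFn α c (x + j)‖ ≤
        A * (1 + Real.log (2 * Real.pi)) * (1 + Real.log c) := fun x => by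
    rw [fundamentalFn_eq_invFourier hαn hc0]
    obtain ⟨h1, h2⟩ := hbound _ _ (by linarith) hl x
    refine ⟨h1, h2.trans ?_⟩
    rw [Real.log_mul (by positivity) hc0.ne', mul_assoc]
    gcongr
    nlinarith
  have hcont : Continuous (fundamentalFn α c) := by
    rw [fundamentalFn_eq_invFourier hαn hc0]
    exact hl.continuous_invFourier
  have hB0 : 0 ≤ A * (1 + Real.log (2 * Real.pi)) * (1 + Real.log c) := by positivity
  refine ⟨integrable_fundamentalHat hαn hc0 hl.integrable, hB, ?_, ?_⟩
  · obtain ⟨T, hT, hT'⟩ := exists_operator (p := ⊤) hB0 (shiftSum (fundamentalFn α c))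
      (shiftSum_add hB) (fun a y => shiftSum_smul a y) (fun y => measurable_shiftSum hcont y)
      (eLpNorm_top_shiftSum_le hB)
    exact ⟨T, fun y => ⟨summable_shiftSum hB y, hT y⟩, hT'⟩
  · obtain ⟨T, hT, hT'⟩ := exists_operator (p := 1) hB0 (shiftSum (fundamentalFn α c))
      (shiftSum_add hB) (fun a y => shiftSum_smul a y) (fun y => measurable_shiftSum hcont y)
      (eLpNorm_one_shiftSum_le hcont hB)
    exact ⟨T, fun y => ⟨summable_shiftSum hB y, hT y⟩, hT'⟩
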